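/- **Setting.** Let $\mathcal W$ be a nonempty closed convex subset of a real Hilbert space (for example $\mathbb R^d$ with the $\ell_2$-norm), let $\lambda\ge 0$, $G,D>0$, $T\in\mathbb N$, and let $f_1,\dots,f_T:\mathcal W\to\mathbb R$ be convex functions with gradients $\nabla f_t$ on $\mathcal W$ such that $\|\nabla f_t(\mathbf w)\|\le G$ for all $\mathbf w\in\mathcal W$, $t\in[T]$, and $\|\mathbf w-\mathbf w'\|\le D$ for all $\mathbf w,\mathbf w'\in\mathcal W$. **DNP-cu with parameters $n,Z$.** Let $\rho=1-1/n$, $\mathrm{erf}(x)=\frac{2}{\sqrt\pi}\int_0^x e^{-s^2}ds$, $\tilde g(x)=\sqrt{n/8}\,Z\,\mathrm{erf}\big(x/\sqrt{8n}\big)e^{x^2/(16n)}$, $g(x)=\max(0,\min(1,\tilde g(x)))$ and $U(n)=\tilde g^{-1}(1)$. On a sequence of bits $b_1,b_2,\dots$, start with $x_1=0$; in round $t$ predict $g(x_t)$, receive $b_t$, and set $x_{t+1}=\rho x_t+b_t$ if $x_t\in[0,U(n)]$, or $x_t<0$ and $b_t>0$, or $x_t>U(n)$ and $b_t<0$; otherwise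 set $x_{t+1}=\rho x_t$. **Combiner with parameters $M,n,Z$.** Given two learners with decisions $\mathbf w_t^1,\mathbf w_t^2\in\mathcal W$, put $\ell_t^j=f_t(\mathbf w_t^j)+\lambda G\|\mathbf w_t^j-\mathbf w_{t+1}^j\|$ and $\ell_t=\frac{\ell_t^1-\ell_t^2}{(1+M)GD}$. Combiner outputs $(1-w_t)\mathbf w_t^1+w_t\mathbf w_t^2$, where $w_t$ is the prediction in round $t$ of DNP-cu with parameters $n,Z$ on the bits $\ell_t/\max(\sqrt\lambda,1)$. **Smoothed OGD with parameters $K,M,Z$.** For $i=1,\dots,K$ let $n^{(i)}=T2^{1-i}$, and let $\mathcal A^i$ be online gradient descent $\mathbf w^i_{t+1}=\Pi_{\mathcal W}[\mathbf w^i_t-\eta^{(i)}\nabla f_t(\mathbf w^i_t)]$ with step size $\eta^{(i)}=\frac DG\sqrt{\frac1{(1+2\lambda)n^{(i)}}}$ and arbitrary initial point $\mathbf w_1^i\in\mathcal W$. Let $\mathcal B^1=\mathcal A^1$, and for $2\le i\le K$ let $\mathcal B^i$ be Combiner with parameters $M,n^{(i)},Z$ applied to $\mathcal B^{i-1}$ (first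 learner) and $\mathcal A^i$ (second learner). The decision $\mathbf w_t$ of smoothed OGD is that of $\mathcal B^K$. **Theorem.** Assume $T\ge\max(\sqrt\lambda\log_2T,\,e)$, and run smoothed OGD with $M=2$, $Z=1/T$ and $$K=\max\left(1,\ \left\lfloor\log_2\frac{T}{32\max(\lambda,1)\log(1/Z)}\right\rfloor+1\right).$$ Then for all $1\le r\le s\le T$, with $\tau=s-r+1$, and every $\mathbf w\in\mathcal W$, $$\sum_{t=r}^s\big(f_t(\mathbf w_t)+\lambda G\|\mathbf w_t-\mathbf w_{t+1}\|-f_t(\mathbf w)\big)\le 2GD\sqrt{(1+\lambda)\tau}+113\,GD\max(\sqrt\lambda,1)\sqrt{\tau\log T},$$ and the right-hand side is at most $115\,GD\sqrt{(1+\lambda)\tau\log T}$, that is, $O\big(\sqrt{(1+\lambda)\tau\log T}\big)$. -/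

import Mathlib

noncomputable section

namespace SOCO

/-! Rounds are indexed by `t = 0, 1, 2, …`, so index `t` stands for round `t + 1`.
Experts and step sizes are indexed by `i = 1, 2, …, K`. -/

/-- The error function `erf x = (2 / √π) ∫₀ˣ exp (-s²) ds`. -/
def erf (x : ℝ) : ℝ :=
  2 / √Real.pi * ∫ s in (0 : ℝ)..x, Real.exp (-s ^ 2)

/-- The unclipped confidence function `g̃`, with parameters `n` and `Z`. -/
def gTilde (n Z x : ℝ) : ℝ :=
  √(n / 8) * Z * erf (x / √(8 * n)) * Real.exp (x ^ 2 / (16 * n))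

/-- The confidence function `g`: the projection of `g̃ x` onto `[0, 1]`. -/
def conf (n Z x : ℝ) : ℝ :=
  max 0 (min 1 (gTilde n Z x))

/-- The threshold `U(n) = g̃⁻¹(1)`. -/
def threshold (n Z : ℝ) : ℝ :=
  Function.invFun (gTilde n Z) 1

open Classical in
/-- One conservative update of the deviation `x` on receiving the bit `b`,
with discount factor `ρ = 1 - 1 / n`. -/
def dnpStep (n Z x b : ℝ) : ℝ :=
  if (0 ≤ x ∧ x ≤ threshold n Z) ∨ (x < 0 ∧ 0 < b) ∨ (threshold n Z < x ∧ b < 0) then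
    (1 - 1 / n) * x + b
  else
    (1 - 1 / n) * x

/-- The deviation of DNP-cu at round `t`, run on the bit sequence `b`. -/
def dnpState (n Z : ℝ) (b : ℕ → ℝ) : ℕ → ℝ
  | 0 => 0
  | t + 1 => dnpStep n Z (dnpState n Z b t) (b t)

/-- The prediction of DNP-cu at round `t`; it depends only on `b 0, …, b (t - 1)`. -/
def dnpPredict (n Z : ℝ) (b : ℕ → ℝ) (t : ℕ) : ℝ :=
  conf n Z (dnpState n Z b t)

variable {E : Type*} [NormedAddCommGroup E] [InnerProductSpace ℝ E]

/-- The projection of `x` onto `W`: the point of `W` nearest to `x`. It exists and is unique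
if `W` is a nonempty closed convex set in a Hilbert space. -/
def proj (W : Set E) (x : E) : E :=
  Classical.epsilon fun y => y ∈ W ∧ ∀ z ∈ W, ‖x - y‖ ≤ ‖x - z‖

/-- Projected online gradient descent with constant step size `η` and first point `w₁`;
`grad t` is the gradient of the loss function of round `t`. -/
def ogd (W : Set E) (grad : ℕ → E → E) (η : ℝ) (w₁ : E) : ℕ → E
  | 0 => w₁
  | t + 1 => proj W (ogd W grad η w₁ t - η • grad t (ogd W grad η w₁ t))

/-- The loss in round `t` of the sequence `u` of decisions: hitting cost plus switching cost. -/
def roundLoss (f : ℕ → E → ℝ) (lam G : ℝ) (u : ℕ → E) (t : ℕ) : ℝ :=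
  f t (u t) + lam * G * ‖u t - u (t + 1)‖

/-- The normalised difference `ℓ_t` of the losses of two learners with decisions `u` and `v`. -/
def lossDiff (f : ℕ → E → ℝ) (lam G D M : ℝ) (u v : ℕ → E) (t : ℕ) : ℝ :=
  (roundLoss f lam G u t - roundLoss f lam G v t) / ((1 + M) * G * D)

/-- The weight that Combiner puts on the second learner in round `t`: the prediction of DNP-cu
run on the scaled bits `ℓ_t / max (√λ) 1`. -/
def combinerWeight (f : ℕ → E → ℝ) (lam G D M n Z : ℝ) (u v : ℕ → E) (t : ℕ) : ℝ :=
  dnpPredict n Z (fun j => lossDiff f lam G D M u v j / max (√lam) 1) t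

/-- The decisions of Combiner applied to two learners with decisions `u` and `v`. -/
def combiner (f : ℕ → E → ℝ) (lam G D M n Z : ℝ) (u v : ℕ → E) (t : ℕ) : E :=
  (1 - combinerWeight f lam G D M n Z u v t) • u t
    + combinerWeight f lam G D M n Z u v t • v t

/-- `n⁽ⁱ⁾ = T 2^(1 - i)`. -/
def intervalLen (T i : ℕ) : ℝ :=
  (T : ℝ) * (2 : ℝ) ^ (1 - (i : ℤ))

/-- `η⁽ⁱ⁾ = (D / G) √(1 / ((1 + 2 λ) n⁽ⁱ⁾))`. -/
def stepSize (T : ℕ) (lam G D : ℝ) (i : ℕ) : ℝ :=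
  D / G * √(1 / ((1 + 2 * lam) * intervalLen T i))

/-- The decisions of the expert `Aⁱ`, an instance of OGD with step size `η⁽ⁱ⁾` that starts
from `w₁ i`. -/
def expert (W : Set E) (grad : ℕ → E → E) (T : ℕ) (lam G D : ℝ) (w₁ : ℕ → E) (i : ℕ) : ℕ → E :=
  ogd W grad (stepSize T lam G D i) (w₁ i)

/-- The decisions of the algorithm `Bⁱ`, for `i ≥ 1` (the value at `i = 0` is a dummy):
`B¹ = A¹`, and `Bⁱ` combines `Bⁱ⁻¹` with `Aⁱ` by Combiner with parameters `M`, `n⁽ⁱ⁾`, `Z`. -/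
def chain (W : Set E) (f : ℕ → E → ℝ) (grad : ℕ → E → E) (T : ℕ) (lam G D M Z : ℝ)
    (w₁ : ℕ → E) : ℕ → ℕ → E
  | 0 => expert W grad T lam G D w₁ 1
  | 1 => expert W grad T lam G D w₁ 1
  | i + 2 =>
      combiner f lam G D M (intervalLen T (i + 2)) Z
        (chain W f grad T lam G D M Z w₁ (i + 1)) (expert W grad T lam G D w₁ (i + 2))

/-- The decisions of smoothed OGD with parameters `K`, `M` and `Z`: those of `Bᴷ`. -/
def smoothedOGD (W : Set E) (f : ℕ → E → ℝ) (grad : ℕ → E → E) (T : ℕ) (lam G D : ℝ)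
    (K : ℕ) (M Z : ℝ) (w₁ : ℕ → E) : ℕ → E :=
  chain W f grad T lam G D M Z w₁ K

/-- The number of experts, `K = ⌊log₂ (T / (32 max(λ, 1) log (1 / Z)))⌋ + 1`. If this integer is
not positive, one expert is used. -/
def numExperts (T : ℕ) (lam Z : ℝ) : ℕ :=
  (max 1 (⌊Real.logb 2 ((T : ℝ) / (32 * max lam 1 * Real.log (1 / Z)))⌋ + 1)).toNat

end SOCO

end

noncomputable section

namespace SOCO

/-! Write Λ = max(√λ, 1), U = `threshold n Z`, and let Φ(x) = ∫₀ˣ g be the potential of the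
deviation. The function g̃ solves g̃' = x g̃/(8n) + (Z/(4√π)) exp(-x²/(16n)). The discount 1 - 1/n
therefore earns x g(x)/n in every round, and up to an additive Z this pays both for the second-order
term of Φ and for the movement of the prediction. With bits |b| ≤ 1/Λ this gives
(`potential_step_le`) ΔΦ + (Λ/3)|Δg| ≤ g(x) b + Z.

Since the deviation stays in [-1, U + 1] and U ≤ 4√(n log(1/Z)), telescoping over any interval of
length τ bounds the reward below by -(U + 1) - τZ (`reward_ge`). The reward minus the sum of the
bits is bounded below by the same quantity with a further loss of τ(U + 1)/n (`reward_sub_ge`).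
Because λ ≤ Λ², the term (Λ/3)|Δg| covers the switching cost caused by changing weights. Hence
Combiner loses O(GDΛ√(n log T)) to its first learner, and to its second learner O(GDΛ(√n +
τ/√n)√(log T)), up to terms in τZ.

For an interval with n⁽ⁱ⁾ between τ and 2τ, OGD with step η⁽ⁱ⁾ has regret at most 2GD√((1+λ)τ), Bⁱ
is close to Aⁱ, and the losses from Bⁱ to Bᴷ form a geometric series in √n⁽ʲ⁾ dominated by √τ.
Intervals not longer than n⁽ᴷ⁾ = O(Λ² log T) need only a bounded loss per round. The bits are
legitimate because every level satisfies λ‖w_t - w_{t+1}‖ ≤ 2D (`norm_chain_sub_succ_le`). -/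

/-! ### The confidence function and its threshold. -/

lemma gTilde_zero (n Z : ℝ) : gTilde n Z 0 = 0 := by
  simp [gTilde, erf]

lemma hasDerivAt_erf (x : ℝ) : HasDerivAt erf (2 / √Real.pi * Real.exp (-x ^ 2)) x := by
  have hc : Continuous fun s : ℝ => Real.exp (-s ^ 2) := by fun_prop
  exact (intervalIntegral.integral_hasDerivAt_right (hc.intervalIntegrable _ _)
    (hc.stronglyMeasurableAtFilter _ _) hc.continuousAt).const_mul _

/-- The differential equation behind the choice of g̃: differentiating `erf` leaves exp(-x²/(8n))
exp(x²/(16n)) = exp(-x²/(16n)), and √(n/8)/√(8n) = 1/8. -/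
lemma hasDerivAt_gTilde {n : ℝ} (hn : 0 < n) (Z x : ℝ) :
    HasDerivAt (gTilde n Z)
      (x / (8 * n) * gTilde n Z x + Z / (4 * √Real.pi) * Real.exp (-(x ^ 2 / (16 * n)))) x := by
  have h1 : HasDerivAt (fun x : ℝ => x / √(8 * n)) (1 / √(8 * n)) x :=
    (hasDerivAt_id x).div_const _
  have h2 := (hasDerivAt_erf (x / √(8 * n))).comp x h1
  have h3 : HasDerivAt (fun x : ℝ => Real.exp (x ^ 2 / (16 * n)))
      (Real.exp (x ^ 2 / (16 * n)) * (2 * x / (16 * n))) x := by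
    have := ((hasDerivAt_pow 2 x).div_const (16 * n)).exp
    simpa using this
  have h4 := (h2.const_mul (√(n / 8) * Z)).mul h3
  refine h4.congr_deriv ?_
  have e8 : √(8 * n) ^ 2 = 8 * n := Real.sq_sqrt (by positivity)
  have en : √(n / 8) / √(8 * n) = 1 / 8 := by
    rw [← Real.sqrt_div' _ (by positivity), show n / 8 / (8 * n) = (1 / 8) ^ 2 by field_simp,
      Real.sqrt_sq (by norm_num)]
  have ee : Real.exp (-(x / √(8 * n)) ^ 2) * Real.exp (x ^ 2 / (16 * n))
      = Real.exp (-(x ^ 2 / (16 * n))) := by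
    rw [← Real.exp_add, div_pow, e8]
    congr 1
    field_simp
    ring
  have hpi : √Real.pi ≠ 0 := (Real.sqrt_pos.2 Real.pi_pos).ne'
  rw [← ee]
  simp only [gTilde, Function.comp]
  have : √(n / 8) = 1 / 8 * √(8 * n) := by
    rw [← en]; field_simp
  rw [this]
  have h8 : √(8 * n) ≠ 0 := (Real.sqrt_pos.2 (by positivity)).ne'
  field_simp
  ring

lemma gTilde_strictMono {n Z : ℝ} (hn : 0 < n) (hZ : 0 < Z) : StrictMono (gTilde n Z) := by
  have hsign : ∀ x, 0 ≤ x * gTilde n Z x := by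
    have hderiv : ∀ x, HasDerivAt erf (2 / √Real.pi * Real.exp (-x ^ 2)) x := hasDerivAt_erf
    have hmono : Monotone erf := monotone_of_hasDerivAt_nonneg hderiv (fun x => by
      simp only [Pi.zero_apply]; positivity)
    have h0 : erf 0 = 0 := by simp [erf]
    intro x
    have : 0 ≤ x * erf (x / √(8 * n)) := by
      rcases le_total 0 x with hx | hx
      · exact mul_nonneg hx (h0 ▸ hmono (by positivity))
      · exact mul_nonneg_of_nonpos_of_nonpos hx
          (h0 ▸ hmono (div_nonpos_of_nonpos_of_nonneg hx (by positivity)))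
    have h : x * gTilde n Z x
        = √(n / 8) * Z * (x * erf (x / √(8 * n))) * Real.exp (x ^ 2 / (16 * n)) := by
      unfold gTilde; ring
    rw [h]; positivity
  refine strictMono_of_hasDerivAt_pos (fun x => hasDerivAt_gTilde hn Z x) fun x => ?_
  have h1 : x / (8 * n) * gTilde n Z x = x * gTilde n Z x / (8 * n) := by ring
  have h2 := hsign x
  rw [h1]
  have hpi : 0 < √Real.pi := Real.sqrt_pos.2 Real.pi_pos
  positivity

lemma gTilde_nonneg {n Z x : ℝ} (hn : 0 < n) (hZ : 0 < Z) (hx : 0 ≤ x) : 0 ≤ gTilde n Z x :=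
  gTilde_zero n Z ▸ (gTilde_strictMono hn hZ).monotone hx

/-- Mean value inequality: on [x, y] the first term of the derivative is largest at y, and the
second is at most Z/7 because 4√π ≥ 7. -/
lemma gTilde_sub_le {n Z x y : ℝ} (hn : 0 < n) (hZ : 0 < Z) (hx : 0 ≤ x) (hxy : x ≤ y) :
    gTilde n Z y - gTilde n Z x ≤ (y * gTilde n Z y / (8 * n) + Z / 7) * (y - x) := by
  have hdiff : Differentiable ℝ (gTilde n Z) := fun z => (hasDerivAt_gTilde hn Z z).differentiableAt
  refine (convex_Icc x y).image_sub_le_mul_sub_of_deriv_le hdiff.continuous.continuousOn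
    hdiff.differentiableOn (fun z hz => ?_) x ⟨le_rfl, hxy⟩ y ⟨hxy, le_rfl⟩ hxy
  rw [interior_Icc] at hz
  rw [(hasDerivAt_gTilde hn Z z).deriv]
  have hz0 : 0 ≤ z := hx.trans hz.1.le
  have h1 : z / (8 * n) * gTilde n Z z ≤ y * gTilde n Z y / (8 * n) := by
    rw [div_mul_eq_mul_div]
    have := (gTilde_strictMono hn hZ).monotone hz.2.le
    have h0 := gTilde_nonneg hn hZ hz0
    have hzy := hz.2.le
    gcongr
    linarith
  have hpi : (7 : ℝ) / 4 ≤ √Real.pi := Real.le_sqrt_of_sq_le (by nlinarith [Real.pi_gt_d2])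
  have h2 : Z / (4 * √Real.pi) * Real.exp (-(z ^ 2 / (16 * n))) ≤ Z / 7 * 1 := by
    gcongr
    · linarith
    · exact Real.exp_le_one_iff.2 (by simp only [Left.neg_nonpos_iff]; positivity)
  linarith

lemma two_thirds_lt_erf {x : ℝ} (hx : 1 ≤ x) : 2 / 3 < erf x := by
  have hmono : Monotone erf := monotone_of_hasDerivAt_nonneg hasDerivAt_erf (fun x => by
      simp only [Pi.zero_apply]; positivity)
  refine lt_of_lt_of_le ?_ (hmono hx)
  -- Integrate exp(-s²) ≥ 1 - s²; the factor 2/√π > 1 makes the final inequality strict.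
  have hint : (2 : ℝ) / 3 ≤ ∫ s in (0 : ℝ)..1, Real.exp (-s ^ 2) := by
    have h1 : ∫ s in (0 : ℝ)..1, (1 - s ^ 2) = 2 / 3 := by
      rw [intervalIntegral.integral_sub (by simp) (by simp)]
      simp; norm_num
    rw [← h1]
    refine intervalIntegral.integral_mono_on (by norm_num)
      (Continuous.intervalIntegrable (by fun_prop) _ _)
      (Continuous.intervalIntegrable (by fun_prop) _ _) fun s _ => ?_
    have := Real.add_one_le_exp (-s ^ 2)
    linarith
  have hpi : √Real.pi < 2 := (Real.sqrt_lt' (by norm_num)).2 (by nlinarith [Real.pi_lt_four])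
  have hpi0 : 0 < √Real.pi := Real.sqrt_pos.2 Real.pi_pos
  have : 1 < 2 / √Real.pi := (one_lt_div hpi0).2 hpi
  unfold erf
  nlinarith

/-- At this point the exponential equals 1/Z and cancels Z; what remains exceeds 2 · (2/3) since
√(n/8) ≥ 2. -/
lemma one_lt_gTilde {n Z : ℝ} (hn : 32 ≤ n) (hZ : 0 < Z) (hL : 1 ≤ Real.log (1 / Z)) :
    1 < gTilde n Z (4 * √(n * Real.log (1 / Z))) := by
  have hn0 : 0 < n := by linarith
  set L := Real.log (1 / Z)
  have hexp : Real.exp ((4 * √(n * L)) ^ 2 / (16 * n)) = 1 / Z := by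
    rw [mul_pow, Real.sq_sqrt (by positivity), show (4 ^ 2 * (n * L)) / (16 * n) = L by field_simp; ring,
      Real.exp_log (by positivity)]
  have harg : 1 ≤ 4 * √(n * L) / √(8 * n) := by
    rw [le_div_iff₀ (by positivity), one_mul]
    refine Real.sqrt_le_iff.2 ⟨by positivity, ?_⟩
    rw [mul_pow, Real.sq_sqrt (by positivity)]
    nlinarith
  have h2 : 2 ≤ √(n / 8) := Real.le_sqrt_of_sq_le (by linarith)
  unfold gTilde
  rw [hexp]
  have := two_thirds_lt_erf harg
  have e : ∀ a e : ℝ, a * Z * e * (1 / Z) = a * e := fun a e => by field_simp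
  rw [e]
  nlinarith

section Threshold

variable {n Z : ℝ} (hn : 32 ≤ n) (hZ : 0 < Z) (hL : 1 ≤ Real.log (1 / Z))
include hn hZ hL

lemma gTilde_threshold : gTilde n Z (threshold n Z) = 1 := by
  have hn0 : 0 < n := by linarith
  have hc : Continuous (gTilde n Z) := continuous_iff_continuousAt.2
    fun z => (hasDerivAt_gTilde hn0 Z z).continuousAt
  have h := intermediate_value_Icc (a := 0) (b := 4 * √(n * Real.log (1 / Z)))
    (by positivity) hc.continuousOn
  -- `Function.invFun` is meaningful only where a preimage exists; the intermediate value theorem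
  -- supplies one.
  obtain ⟨x, -, hx⟩ := h ⟨by rw [gTilde_zero]; norm_num, (one_lt_gTilde hn hZ hL).le⟩
  exact Function.invFun_eq ⟨x, hx⟩

lemma threshold_pos : 0 < threshold n Z := by
  have h := gTilde_threshold hn hZ hL
  rw [← (gTilde_strictMono (n := n) (by linarith) hZ).lt_iff_lt, h, gTilde_zero]
  exact one_pos

lemma threshold_le : threshold n Z ≤ 4 * √(n * Real.log (1 / Z)) := by
  rw [← (gTilde_strictMono (n := n) (by linarith) hZ).le_iff_le, gTilde_threshold hn hZ hL]
  exact (one_lt_gTilde hn hZ hL).le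

lemma conf_eq_gTilde_clamp (x : ℝ) :
    conf n Z x = gTilde n Z (max 0 (min (threshold n Z) x)) := by
  have hm := (gTilde_strictMono (n := n) (by linarith) hZ).monotone
  rw [hm.map_max, hm.map_min, gTilde_threshold hn hZ hL, gTilde_zero, conf]

lemma conf_sub_le {a b : ℝ} (hab : a ≤ b) :
    conf n Z b - conf n Z a ≤
      (max 0 (min (threshold n Z) b) * conf n Z b / (8 * n) + Z / 7) * (b - a) := by
  have hn0 : 0 < n := by linarith
  rw [conf_eq_gTilde_clamp hn hZ hL, conf_eq_gTilde_clamp hn hZ hL]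
  set U := threshold n Z
  have hcl : max 0 (min U a) ≤ max 0 (min U b) := by gcongr
  refine (gTilde_sub_le hn0 hZ (le_max_left _ _) hcl).trans ?_
  have : 0 ≤ gTilde n Z (max 0 (min U b)) := gTilde_nonneg hn0 hZ (le_max_left _ _)
  have h0 : 0 ≤ max 0 (min U b) := le_max_left _ _
  gcongr ?_ * ?_
  rcases max_cases 0 (min U a) with h | h <;> rcases min_cases U a with h' | h' <;>
  rcases max_cases 0 (min U b) with h1 | h1 <;> rcases min_cases U b with h1' | h1' <;> linarith

lemma conf_of_threshold_le {x : ℝ} (hx : threshold n Z ≤ x) : conf n Z x = 1 := by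
  rw [conf_eq_gTilde_clamp hn hZ hL, min_eq_left hx, max_eq_right (threshold_pos hn hZ hL).le,
    gTilde_threshold hn hZ hL]

end Threshold

lemma conf_nonneg (n Z x : ℝ) : 0 ≤ conf n Z x := le_max_left _ _

lemma conf_le_one (n Z x : ℝ) : conf n Z x ≤ 1 := max_le zero_le_one (min_le_left _ _)

lemma conf_monotone {n Z : ℝ} (hn : 0 < n) (hZ : 0 < Z) : Monotone (conf n Z) := fun a b hab => by
  have := (gTilde_strictMono hn hZ).monotone hab
  unfold conf
  gcongr

lemma conf_of_nonpos {n Z x : ℝ} (hn : 0 < n) (hZ : 0 < Z) (hx : x ≤ 0) : conf n Z x = 0 := by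
  have := (gTilde_strictMono hn hZ).monotone hx
  rw [gTilde_zero] at this
  exact max_eq_left ((min_le_right _ _).trans this)

/-! ### The potential. -/

/-- The potential `∫₀ˣ g` of the deviation `x`. -/
def potential (n Z x : ℝ) : ℝ := ∫ y in (0 : ℝ)..x, conf n Z y

/-- The potential is convex because `conf` is monotone; this is its tangent inequality at b. -/
lemma potential_sub_le {n Z : ℝ} (hn : 0 < n) (hZ : 0 < Z) (a b : ℝ) :
    potential n Z b - potential n Z a ≤ conf n Z b * (b - a) := by
  have hm := conf_monotone hn hZ
  have hi : ∀ p q, IntervalIntegrable (conf n Z) MeasureTheory.volume p q :=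
    fun p q => hm.intervalIntegrable
  rw [potential, potential, intervalIntegral.integral_interval_sub_left (hi _ _) (hi _ _)]
  rcases le_total a b with h | h
  · have := intervalIntegral.integral_mono_on h (hi a b)
      (intervalIntegrable_const (c := conf n Z b)) fun y hy => hm hy.2
    simpa [mul_comm] using this
  · have := intervalIntegral.integral_mono_on h
      (intervalIntegrable_const (c := conf n Z b)) (hi b a) fun y hy => hm hy.1
    rw [intervalIntegral.integral_symm]
    simp at this
    linarith

lemma potential_zero (n Z : ℝ) : potential n Z 0 = 0 := by simp [potential]

lemma potential_nonneg {n Z : ℝ} (hn : 0 < n) (hZ : 0 < Z) (x : ℝ) : 0 ≤ potential n Z x := by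
  have := potential_sub_le hn hZ x 0
  rw [conf_of_nonpos hn hZ le_rfl, potential_zero] at this
  linarith

lemma potential_le {n Z : ℝ} (hn : 0 < n) (hZ : 0 < Z) (x : ℝ) : potential n Z x ≤ max x 0 := by
  have := potential_sub_le hn hZ 0 x
  rw [potential_zero, sub_zero, sub_zero] at this
  refine this.trans ?_
  rcases le_total 0 x with h | h
  · rw [max_eq_left h]
    exact mul_le_of_le_one_left h (conf_le_one _ _ _)
  · rw [conf_of_nonpos hn hZ h, max_eq_right h, zero_mul]

lemma sub_threshold_le_potential {n Z : ℝ} (hn : 32 ≤ n) (hZ : 0 < Z)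
    (hL : 1 ≤ Real.log (1 / Z)) (x : ℝ) : x - threshold n Z ≤ potential n Z x := by
  have hn0 : 0 < n := by linarith
  have := potential_sub_le hn0 hZ x (threshold n Z)
  rw [conf_of_threshold_le hn hZ hL le_rfl] at this
  linarith [potential_nonneg hn0 hZ (threshold n Z)]

lemma dnpStep_eq (n Z x b : ℝ) :
    ∃ b', dnpStep n Z x b = x + (b' - x / n) ∧ (b' = b ∨ b' = 0 ∧
      ((x < 0 ∧ b ≤ 0) ∨ (threshold n Z < x ∧ 0 ≤ b))) := by
  unfold dnpStep
  split_ifs with h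
  · exact ⟨b, by ring, .inl rfl⟩
  · refine ⟨0, by ring, .inr ⟨rfl, ?_⟩⟩
    push Not at h
    obtain ⟨h1, h2, h3⟩ := h
    rcases lt_or_ge x 0 with hx | hx
    · exact .inl ⟨hx, h2 hx⟩
    · exact .inr ⟨h1 hx, h3 (h1 hx)⟩

/-- The growth rate `√(log (1 / Z) / n)` of the confidence function near the threshold. -/
def confRate (n Z : ℝ) : ℝ := √(Real.log (1 / Z) / n)

/-! ### One-step analysis of DNP-cu and its reward on intervals. -/

section Step

variable {n Z Lam : ℝ} (hLam : 1 ≤ Lam) (hZ : 0 < Z) (hL : 1 ≤ Real.log (1 / Z))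
  (hn : 32 * Lam ^ 2 * Real.log (1 / Z) ≤ n)
include hLam hL hn

lemma mul_le_of_large : 32 * Lam ≤ n := by
  have : Lam ≤ Lam ^ 2 := by nlinarith
  nlinarith [mul_le_mul (le_refl (Lam ^ 2)) hL zero_le_one (by positivity)]

lemma le_of_large : 32 ≤ n := by linarith [mul_le_of_large hLam hL hn]

lemma mul_confRate_le : Lam * confRate n Z ≤ 177 / 1000 := by
  have hn0 : 0 < n := by linarith [le_of_large hLam hL hn]
  have hsq : confRate n Z ^ 2 = Real.log (1 / Z) / n := Real.sq_sqrt (by positivity)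
  -- The square is at most 1/32, and 177/1000 slightly exceeds 1/√32.
  refine abs_le_of_sq_le_sq' ?_ (by norm_num) |>.2
  rw [mul_pow, hsq, mul_div_assoc', div_le_iff₀ hn0]
  linarith

lemma inv_le_confRate_sq : 1 / n ≤ confRate n Z ^ 2 := by
  have hn0 : 0 < n := by linarith [le_of_large hLam hL hn]
  have hsq : confRate n Z ^ 2 = Real.log (1 / Z) / n := Real.sq_sqrt (by positivity)
  rw [hsq]
  gcongr

lemma inv_le_confRate : 1 / n ≤ 177 / 1000 * confRate n Z := by
  have hq := mul_confRate_le hLam hL hn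
  have hq0 : 0 ≤ confRate n Z := Real.sqrt_nonneg _
  refine (inv_le_confRate_sq hLam hL hn).trans ?_
  rw [sq]
  gcongr
  nlinarith

include hZ

lemma threshold_le_mul_confRate : threshold n Z ≤ 4 * n * confRate n Z := by
  have hn0 : 0 < n := by linarith [le_of_large hLam hL hn]
  refine (threshold_le (le_of_large hLam hL hn) hZ hL).trans_eq ?_
  rw [confRate, mul_assoc, show n * Real.log (1 / Z) = n ^ 2 * (Real.log (1 / Z) / n) by field_simp,
    Real.sqrt_mul (by positivity), Real.sqrt_sq hn0.le]

/-- The bit contributes at most 1 and the discount at most 4 · 0.177 + 1/32, in total below 7/4. -/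
lemma dnp_increment_le {x b : ℝ} (hx : x ∈ Set.Icc (-1) (threshold n Z + 1))
    (hb : |b| ≤ 1 / Lam) : Lam * |b - x / n| ≤ 7 / 4 := by
  have hn1 := mul_le_of_large hLam hL hn
  have hn0 : 0 < n := by linarith
  have hU := threshold_le_mul_confRate hLam hZ hL hn
  have hq := mul_confRate_le hLam hL hn
  have hU0 := threshold_pos (le_of_large hLam hL hn) hZ hL
  have h1 : |x| ≤ 4 * n * confRate n Z + 1 := abs_le.2 ⟨by linarith [hx.1], by linarith [hx.2]⟩
  have h2 : Lam * |x / n| ≤ 708 / 1000 + 1 / 32 := by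
    rw [abs_div, abs_of_pos hn0, mul_div_assoc', div_le_iff₀ hn0]
    nlinarith
  have h3 : Lam * |b| ≤ 1 := by
    rw [le_div_iff₀ (by linarith)] at hb
    linarith
  have := abs_sub b (x / n)
  nlinarith

lemma conf_two_le : conf n Z 2 ≤ 3 / 10 * Z := by
  have hn1 := le_of_large hLam hL hn
  have h := conf_sub_le hn1 hZ hL (a := 0) (b := 2) (by norm_num)
  rw [conf_of_nonpos (by linarith) hZ le_rfl] at h
  have hY : max 0 (min (threshold n Z) 2) ≤ 2 := by simp
  have h0 := conf_nonneg n Z 2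
  have h1 : max 0 (min (threshold n Z) 2) * conf n Z 2 / (8 * n) ≤ conf n Z 2 / 128 := by
    rw [div_le_div_iff₀ (by linarith) (by norm_num)]
    nlinarith [mul_le_mul_of_nonneg_right hY h0, mul_le_mul_of_nonneg_left hn1 h0]
  linarith

lemma clamp_div_le (y : ℝ) : max 0 (min (threshold n Z) y) / (8 * n) ≤ confRate n Z / 2 := by
  have hn0 : 0 < n := by linarith [le_of_large hLam hL hn]
  have hU := threshold_le_mul_confRate hLam hZ hL hn
  have hU0 := threshold_pos (le_of_large hLam hL hn) hZ hL
  have : max 0 (min (threshold n Z) y) ≤ threshold n Z := max_le hU0.le (min_le_left _ _)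
  rw [div_le_iff₀ (by linarith)]
  linarith

/-- A bound on the slope of `conf` up to the larger end of a step of length at most `7 / 4`. -/
lemma abs_conf_sub_le_slope {x b : ℝ} (hx : x ∈ Set.Icc (-1) (threshold n Z + 1))
    (hb : |b| ≤ 1 / Lam) : ∃ κ, 0 ≤ κ ∧ |conf n Z (x + (b - x / n)) - conf n Z x| ≤ κ * |b - x / n| ∧
      4 * κ ≤ x * conf n Z x / n + Z ∧ κ ≤ confRate n Z / 2 + Z / 7 := by
  have hn1 := le_of_large hLam hL hn
  have hn0 : 0 < n := by linarith
  have hm := conf_monotone (n := n) hn0 hZ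
  have hcl := clamp_div_le hLam hZ hL hn
  have hq : confRate n Z ≤ 177 / 1000 := by
    have := mul_confRate_le hLam hL hn
    have hq0 : 0 ≤ confRate n Z := Real.sqrt_nonneg _
    nlinarith
  have hU := threshold_le_mul_confRate hLam hZ hL hn
  set d := b - x / n with hd
  have hslope : ∀ y, max 0 (min (threshold n Z) y) * conf n Z y / (8 * n) + Z / 7
      ≤ confRate n Z / 2 + Z / 7 := fun y => by
    have h1 := conf_le_one n Z y
    have h0 := conf_nonneg n Z y
    have h2 := hcl y
    have hp : 0 ≤ max 0 (min (threshold n Z) y) / (8 * n) := by positivity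
    rw [mul_div_right_comm]
    nlinarith
  -- For a downward step the slope at x itself serves. For an upward step the slope at x + d must be
  -- compared back to x.
  rcases le_total d 0 with hd0 | hd0
  · refine ⟨_, ?_, ?_, ?_, hslope x⟩
    · have := conf_nonneg n Z x
      positivity
    · have := conf_sub_le hn1 hZ hL (a := x + d) (b := x) (by linarith)
      rw [abs_of_nonpos (by linarith [hm (show x + d ≤ x by linarith)]), abs_of_nonpos hd0]
      calc _ = conf n Z x - conf n Z (x + d) := by ring
        _ ≤ _ := this
        _ = _ := by ring
    · have h1 : max 0 (min (threshold n Z) x) * conf n Z x ≤ x * conf n Z x := by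
        rcases le_total x 0 with h | h
        · rw [conf_of_nonpos hn0 hZ h]; simp
        · exact mul_le_mul_of_nonneg_right (max_le h (min_le_right _ _)) (conf_nonneg _ _ _)
      have h2 : 0 ≤ x * conf n Z x := (mul_nonneg (le_max_left _ _) (conf_nonneg _ _ _)).trans h1
      have h3 : max 0 (min (threshold n Z) x) * conf n Z x / (8 * n) ≤ x * conf n Z x / n / 8 := by
        rw [div_div, mul_comm n 8]; gcongr
      have : 0 ≤ x * conf n Z x / n := by positivity
      linarith
  · set Y := max 0 (min (threshold n Z) (x + d)) with hY
    have hY0 : 0 ≤ Y := le_max_left _ _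
    have hc := conf_sub_le hn1 hZ hL (a := x) (b := x + d) (by linarith)
    rw [← hY] at hc
    refine ⟨_, ?_, ?_, ?_, hslope (x + d)⟩
    · have := conf_nonneg n Z (x + d)
      positivity
    · rw [abs_of_nonneg (by linarith [hm (show x ≤ x + d by linarith)]), abs_of_nonneg hd0]
      calc _ ≤ _ := hc
        _ = _ := by ring
    · rw [← hY]
      have hb1 : b ≤ 1 := (le_abs_self b).trans (hb.trans ((div_le_one (by linarith)).2 hLam))
      have hxn : -(1 / 32) ≤ x / n := by
        rw [le_div_iff₀ hn0]; linarith [hx.1]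
      have hd1 : d ≤ 33 / 32 := by linarith
      have hYn : Y / (8 * n) ≤ 885 / 10000 := by linarith [hcl (x + d)]
      have hYn0 : 0 ≤ Y / (8 * n) := by positivity
      have hc0 := conf_nonneg n Z (x + d)
      have hcx := conf_nonneg n Z x
      rw [mul_div_right_comm] at hc
      have hA : (Y / (8 * n) * conf n Z (x + d) + Z / 7) * (x + d - x)
          ≤ (885 / 10000 * conf n Z (x + d) + Z / 7) * (33 / 32) := by
        gcongr <;> linarith
      -- Solve `hc` for the value at x + d: it grows by a factor of at most 1/(1 - 0.0885 · 33/32),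
      -- plus a multiple of Z.
      have hgrow : conf n Z (x + d) ≤ 111 / 100 * conf n Z x + 17 / 100 * Z := by linarith
      have hmain : Y * conf n Z (x + d) ≤ 17 / 10 * (x * conf n Z x) + n * Z / 2 := by
        rcases le_total 0 x with hx0 | hx0
        · have hxn0 : 0 ≤ x / n := by positivity
          have hYx : Y ≤ x + 1 := max_le (by linarith) ((min_le_right _ _).trans (by linarith))
          have hxle : x ≤ 71 / 100 * n + 1 := by nlinarith [hx.2]
          -- Near 0 the gain x g(x)/n is too small to absorb g(x) alone; there g is itself of order
          -- Z by `conf_two_le`.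
          have h2 : conf n Z x ≤ x * conf n Z x / 2 + 3 / 10 * Z := by
            rcases le_total x 2 with h | h
            · have := (hm h).trans (conf_two_le hLam hZ hL hn)
              have := mul_nonneg hx0 hcx
              linarith
            · nlinarith
          have h3 : Y * conf n Z (x + d) ≤ (x + 1) * (111 / 100 * conf n Z x + 17 / 100 * Z) :=
            mul_le_mul hYx hgrow hc0 (by linarith)
          nlinarith
        · have hYx : Y ≤ 1 := by
            refine max_le (by norm_num) ((min_le_right _ _).trans ?_)
            have : x + d = x * (1 - 1 / n) + b := by rw [hd]; ring
            have h1n : 1 / n ≤ 1 := (div_le_one hn0).2 (by linarith)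
            nlinarith
          rw [conf_of_nonpos hn0 hZ hx0] at hgrow ⊢
          nlinarith
      have h3 : Y * conf n Z (x + d) / (8 * n) ≤ 17 / 80 * (x * conf n Z x / n) + Z / 16 := by
        rw [div_le_iff₀ (by positivity)]
        calc _ ≤ _ := hmain
          _ = _ := by field_simp; ring
      have h4 : 0 ≤ x * conf n Z x := by
        rcases le_total 0 x with h | h
        · positivity
        · rw [conf_of_nonpos hn0 hZ h]; simp
      have h5 : 0 ≤ x * conf n Z x / n := by positivity
      linarith

/-- Both costs are multiples of the slope κ: κd² ≤ (49/16)κ and (Λ/3)κ|d| ≤ (7/12)κ. Their sum is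
below 4κ, which the discount gain x g(x)/n plus Z pays for. -/
lemma potential_step_le {x b : ℝ} (hx : x ∈ Set.Icc (-1) (threshold n Z + 1))
    (hb : |b| ≤ 1 / Lam) :
    potential n Z (x + (b - x / n)) - potential n Z x
      + Lam / 3 * |conf n Z x - conf n Z (x + (b - x / n))| ≤ conf n Z x * b + Z := by
  have hn0 : 0 < n := by linarith [le_of_large hLam hL hn]
  obtain ⟨κ, hκ0, h1, h2, -⟩ := abs_conf_sub_le_slope hLam hZ hL hn hx hb
  have h3 := potential_sub_le hn0 hZ x (x + (b - x / n))
  have hd := dnp_increment_le hLam hZ hL hn hx hb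
  rw [abs_sub_comm (conf n Z x)]
  have e : conf n Z x * (b - x / n) = conf n Z x * b - x * conf n Z x / n := by ring
  set d := b - x / n
  set δ := conf n Z (x + d) - conf n Z x with hδ
  have h4 : conf n Z (x + d) * (x + d - x) ≤ conf n Z x * d + κ * |d| * |d| := by
    have : conf n Z (x + d) * (x + d - x) = conf n Z x * d + δ * d := by rw [hδ]; ring
    have h' : δ * d ≤ |δ| * |d| := (le_abs_self _).trans (abs_mul _ _).le
    nlinarith [mul_le_mul_of_nonneg_right h1 (abs_nonneg d)]
  have hd1 : |d| ≤ 7 / 4 := by nlinarith [abs_nonneg d]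
  have h5 : κ * |d| * |d| ≤ κ * (49 / 16) := by
    rw [mul_assoc]; gcongr; nlinarith [abs_nonneg d]
  have h6 : Lam / 3 * |δ| ≤ κ * (7 / 12) := by
    calc Lam / 3 * |δ| ≤ Lam / 3 * (κ * |d|) := by gcongr
      _ = κ * (Lam * |d|) / 3 := by ring
      _ ≤ κ * (7 / 4) / 3 := by gcongr
      _ = _ := by ring
  linarith

lemma dnpStep_mem {x b : ℝ} (hx : x ∈ Set.Icc (-1) (threshold n Z + 1)) (hb : |b| ≤ 1 / Lam) :
    dnpStep n Z x b ∈ Set.Icc (-1) (threshold n Z + 1) := by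
  have hn1 := le_of_large hLam hL hn
  have hn0 : 0 < n := by linarith
  have hU0 := threshold_pos hn1 hZ hL
  have hb1 : |b| ≤ 1 := hb.trans ((div_le_one (by linarith)).2 hLam)
  obtain ⟨hb2, hb3⟩ := abs_le.1 hb1
  have h1n : 1 / n ≤ 1 := (div_le_one hn0).2 (by linarith)
  have h1n0 : 0 < 1 / n := by positivity
  obtain ⟨hx1, hx2⟩ := hx
  unfold dnpStep
  split_ifs with h
  · rcases h with ⟨h1, h2⟩ | ⟨h1, h2⟩ | ⟨h1, h2⟩ <;> constructor <;> nlinarith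
  · constructor <;> nlinarith

lemma reward_step_ge {x b : ℝ} (hx : x ∈ Set.Icc (-1) (threshold n Z + 1)) (hb : |b| ≤ 1 / Lam) :
    potential n Z (dnpStep n Z x b) - potential n Z x - Z
      ≤ conf n Z x * b - Lam / 3 * |conf n Z x - conf n Z (dnpStep n Z x b)| ∧
    potential n Z (dnpStep n Z x b) - potential n Z x - (dnpStep n Z x b - x) - x / n - Z
      ≤ conf n Z x * b - b - Lam / 3 * |conf n Z x - conf n Z (dnpStep n Z x b)| := by
  have hn1 := le_of_large hLam hL hn
  obtain ⟨b', h, hb'⟩ := dnpStep_eq n Z x b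
  rw [h]
  have hb1 : |b'| ≤ 1 / Lam := by
    rcases hb' with rfl | ⟨rfl, -⟩
    · exact hb
    · simp; linarith
  have := potential_step_le hLam hZ hL hn hx hb1
  -- The conservative rule drops a bit only where this is harmless: b ≤ 0 with g = 0, or b ≥ 0 with
  -- g = 1.
  have h2 : conf n Z x * b' ≤ conf n Z x * b ∧ conf n Z x * b' - b' ≤ conf n Z x * b - b := by
    rcases hb' with rfl | ⟨rfl, ⟨h1, h2⟩ | ⟨h1, h2⟩⟩
    · simp
    · rw [conf_of_nonpos (by linarith) hZ h1.le]; simp [h2]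
    · rw [conf_of_threshold_le hn1 hZ hL h1.le]; simp [h2]
  constructor <;> linarith [h2.1, h2.2]

lemma conf_step_le {x b : ℝ} (hnZ : n * Z ≤ 1) (hx : x ∈ Set.Icc (-1) (threshold n Z + 1))
    (hb : |b| ≤ 1 / Lam) :
    Lam ^ 2 * |conf n Z x - conf n Z (dnpStep n Z x b)| ≤ Lam * confRate n Z := by
  have hn0 : 0 < n := by linarith [le_of_large hLam hL hn]
  obtain ⟨b', h, hb'⟩ := dnpStep_eq n Z x b
  rw [h]
  have hb1 : |b'| ≤ 1 / Lam := by
    rcases hb' with rfl | ⟨rfl, -⟩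
    · exact hb
    · simp; linarith
  obtain ⟨κ, hκ0, h1, -, h2⟩ := abs_conf_sub_le_slope hLam hZ hL hn hx hb1
  have hd := dnp_increment_le hLam hZ hL hn hx hb1
  have hZn : Z ≤ 177 / 1000 * confRate n Z :=
    ((le_div_iff₀ hn0).2 (by linarith)).trans (inv_le_confRate hLam hL hn)
  have hq0 : 0 ≤ confRate n Z := Real.sqrt_nonneg _
  rw [abs_sub_comm]
  calc _ ≤ Lam ^ 2 * (κ * |b' - x / n|) := by gcongr
    _ = κ * Lam * (Lam * |b' - x / n|) := by ring
    _ ≤ κ * Lam * (7 / 4) := by gcongr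
    _ ≤ (confRate n Z / 2 + 177 / 1000 * confRate n Z / 7) * Lam * (7 / 4) := by gcongr; linarith
    _ ≤ _ := by nlinarith [mul_nonneg (zero_le_one.trans hLam) hq0]

variable {T : ℕ} {b : ℕ → ℝ} (hb : ∀ t < T, |b t| ≤ 1 / Lam)
include hb

lemma dnpState_mem {t : ℕ} (ht : t ≤ T) : dnpState n Z b t ∈ Set.Icc (-1) (threshold n Z + 1) := by
  induction t with
  | zero =>
    have := threshold_pos (le_of_large hLam hL hn) hZ hL
    simp only [dnpState]
    constructor <;> linarith
  | succ t ih => exact dnpStep_mem hLam hZ hL hn (ih (by omega)) (hb t (by omega))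

lemma dnpPredict_sub_le (hnZ : n * Z ≤ 1) {t : ℕ} (ht : t < T) :
    Lam ^ 2 * |dnpPredict n Z b t - dnpPredict n Z b (t + 1)| ≤ Lam * confRate n Z :=
  conf_step_le hLam hZ hL hn hnZ (dnpState_mem hLam hZ hL hn hb ht.le) (hb t ht)

lemma reward_ge {r q : ℕ} (hrq : r ≤ q) (hqT : q ≤ T) :
    -(threshold n Z + 1) - ((q : ℝ) - r) * Z ≤
      ∑ t ∈ Finset.Ico r q, (dnpPredict n Z b t * b t
        - Lam / 3 * |dnpPredict n Z b t - dnpPredict n Z b (t + 1)|) := by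
  have hn0 : 0 < n := by linarith [le_of_large hLam hL hn]
  have h : ∑ t ∈ Finset.Ico r q, (potential n Z (dnpState n Z b (t + 1))
      - potential n Z (dnpState n Z b t) - Z) ≤ ∑ t ∈ Finset.Ico r q, (dnpPredict n Z b t * b t
        - Lam / 3 * |dnpPredict n Z b t - dnpPredict n Z b (t + 1)|) := by
    refine Finset.sum_le_sum fun t ht => ?_
    have ht' : t < T := by have := (Finset.mem_Ico.1 ht).2; omega
    exact (reward_step_ge hLam hZ hL hn (dnpState_mem hLam hZ hL hn hb ht'.le) (hb t ht')).1
  refine le_trans ?_ h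
  rw [Finset.sum_sub_distrib, Finset.sum_Ico_sub (fun t => potential n Z (dnpState n Z b t)) hrq]
  simp only [Finset.sum_const, Nat.card_Ico, nsmul_eq_mul, Nat.cast_sub hrq]
  have h1 := potential_nonneg hn0 hZ (dnpState n Z b q)
  have h2 := potential_le hn0 hZ (dnpState n Z b r)
  have h3 := (dnpState_mem hLam hZ hL hn hb (hrq.trans hqT)).2
  have h4 := threshold_pos (le_of_large hLam hL hn) hZ hL
  have h5 : max (dnpState n Z b r) 0 ≤ threshold n Z + 1 := max_le h3 (by linarith)
  linarith

/-- Here Φ(x) - x is telescoped; it is at least -U at the end and at most 1 at the start. The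
discount leaves x/n ≤ (U + 1)/n per round. -/
lemma reward_sub_ge {r q : ℕ} (hrq : r ≤ q) (hqT : q ≤ T) :
    -(threshold n Z + 1) - ((q : ℝ) - r) * ((threshold n Z + 1) / n + Z) ≤
      ∑ t ∈ Finset.Ico r q, (dnpPredict n Z b t * b t - b t
        - Lam / 3 * |dnpPredict n Z b t - dnpPredict n Z b (t + 1)|) := by
  have hn0 : 0 < n := by linarith [le_of_large hLam hL hn]
  set U := threshold n Z with hU
  have h : ∑ t ∈ Finset.Ico r q, ((potential n Z (dnpState n Z b (t + 1)) - dnpState n Z b (t + 1))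
      - (potential n Z (dnpState n Z b t) - dnpState n Z b t) - ((U + 1) / n + Z))
      ≤ ∑ t ∈ Finset.Ico r q, (dnpPredict n Z b t * b t - b t
        - Lam / 3 * |dnpPredict n Z b t - dnpPredict n Z b (t + 1)|) := by
    refine Finset.sum_le_sum fun t ht => ?_
    have ht' : t < T := by have := (Finset.mem_Ico.1 ht).2; omega
    have hm := dnpState_mem hLam hZ hL hn hb ht'.le
    have h1 := (reward_step_ge hLam hZ hL hn hm (hb t ht')).2
    have h2 : dnpState n Z b t / n ≤ (U + 1) / n := by gcongr; exact hm.2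
    refine le_trans ?_ h1
    change _ ≤ potential n Z (dnpState n Z b (t + 1)) - _ - (dnpState n Z b (t + 1) - _) - _ - _
    linarith
  refine le_trans ?_ h
  rw [Finset.sum_sub_distrib,
    Finset.sum_Ico_sub (fun t => potential n Z (dnpState n Z b t) - dnpState n Z b t) hrq]
  simp only [Finset.sum_const, Nat.card_Ico, nsmul_eq_mul, Nat.cast_sub hrq]
  have h1 := sub_threshold_le_potential (le_of_large hLam hL hn) hZ hL (dnpState n Z b q)
  have h2 := potential_le hn0 hZ (dnpState n Z b r)
  have h3 := (dnpState_mem hLam hZ hL hn hb (hrq.trans hqT)).1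
  have h5 : max (dnpState n Z b r) 0 ≤ dnpState n Z b r + 1 := max_le (by linarith) (by linarith)
  linarith

end Step

variable {E : Type*} [NormedAddCommGroup E] [InnerProductSpace ℝ E]

/-! ### Projection and online gradient descent with switching cost. -/

lemma proj_spec [CompleteSpace E] {W : Set E} (hne : W.Nonempty) (hcl : IsClosed W)
    (hcv : Convex ℝ W) (x : E) : proj W x ∈ W ∧ ∀ z ∈ W, ‖x - proj W x‖ ≤ ‖x - z‖ := by
  refine Classical.epsilon_spec (p := fun y => y ∈ W ∧ ∀ z ∈ W, ‖x - y‖ ≤ ‖x - z‖) ?_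
  obtain ⟨v, hv, h⟩ := exists_norm_eq_iInf_of_complete_convex hne hcl.isComplete hcv x
  exact ⟨v, hv, fun z hz => h ▸ ciInf_le ⟨0, by rintro _ ⟨w, rfl⟩; positivity⟩ (⟨z, hz⟩ : W)⟩

lemma inner_sub_proj_nonpos [CompleteSpace E] {W : Set E} (hcl : IsClosed W)
    (hcv : Convex ℝ W) (x : E) {z : E} (hz : z ∈ W) :
    inner ℝ (x - proj W x) (z - proj W x) ≤ 0 := by
  obtain ⟨h1, h2⟩ := proj_spec ⟨z, hz⟩ hcl hcv x
  refine (norm_eq_iInf_iff_real_inner_le_zero hcv h1).1 (le_antisymm ?_ ?_) z hz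
  · have : Nonempty W := ⟨⟨z, hz⟩⟩
    exact le_ciInf fun w => h2 w w.2
  · exact ciInf_le ⟨0, by rintro _ ⟨w, rfl⟩; positivity⟩ (⟨_, h1⟩ : W)

lemma norm_proj_sub_le [CompleteSpace E] {W : Set E} (hcl : IsClosed W)
    (hcv : Convex ℝ W) (x : E) {z : E} (hz : z ∈ W) : ‖proj W x - z‖ ≤ ‖x - z‖ := by
  have h := inner_sub_proj_nonpos hcl hcv x hz
  have e : x - z = (x - proj W x) - (z - proj W x) := by abel
  have h2 : ‖x - z‖ ^ 2 = ‖x - proj W x‖ ^ 2 - 2 * inner ℝ (x - proj W x) (z - proj W x)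
      + ‖z - proj W x‖ ^ 2 := by
    rw [e]; exact norm_sub_sq_real _ _
  rw [norm_sub_rev]
  refine abs_le_of_sq_le_sq' ?_ (norm_nonneg _) |>.2
  nlinarith [sq_nonneg ‖x - proj W x‖]

/-- Restricting f to the segment from x to y reduces this to the one-dimensional bound of the
derivative at 0 by the slope; a gradient within W suffices. -/
lemma ConvexOn.le_inner_gradient {W : Set E} {f : E → ℝ} {g x y : E} [CompleteSpace E]
    (hf : ConvexOn ℝ W f) (hg : HasGradientWithinAt f g W x) (hx : x ∈ W) (hy : y ∈ W) :
    f x - f y ≤ inner ℝ g (x - y) := by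
  have hconv := hf.comp_affineMap (AffineMap.lineMap (k := ℝ) x y)
  have hg' : HasFDerivWithinAt f (InnerProductSpace.toDual ℝ E g) W
      (AffineMap.lineMap (k := ℝ) x y 0) := by
    simpa using hg.hasFDerivWithinAt
  have hd := hg'.comp_hasDerivWithinAt (0 : ℝ)
    (AffineMap.hasDerivWithinAt_lineMap (a := x) (b := y)) (Set.mapsTo_preimage _ _)
  have h := hconv.le_slope_of_hasDerivWithinAt (x := 0) (y := 1) (by simpa) (by simpa) one_pos hd
  rw [InnerProductSpace.toDual_apply_apply] at h
  simp only [slope_def_field, Function.comp, AffineMap.lineMap_apply_zero,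
    AffineMap.lineMap_apply_one, sub_zero, div_one] at h
  rw [← neg_sub y x, inner_neg_right]
  linarith

section OGD

variable [CompleteSpace E] {W : Set E} {f : ℕ → E → ℝ} {grad : ℕ → E → E} {T : ℕ}
  {lam G D η : ℝ} {w₁ : E}

lemma ogd_mem (hWclosed : IsClosed W) (hWconvex : Convex ℝ W) (hw₁ : w₁ ∈ W) (t : ℕ) :
    ogd W grad η w₁ t ∈ W := by
  cases t with
  | zero => exact hw₁
  | succ t => exact (proj_spec ⟨w₁, hw₁⟩ hWclosed hWconvex _).1

lemma norm_ogd_sub_succ_le (hWclosed : IsClosed W) (hWconvex : Convex ℝ W)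
    (hgradbound : ∀ t < T, ∀ x ∈ W, ‖grad t x‖ ≤ G) (hw₁ : w₁ ∈ W) (hη : 0 ≤ η) {t : ℕ}
    (ht : t < T) : ‖ogd W grad η w₁ t - ogd W grad η w₁ (t + 1)‖ ≤ η * G := by
  have hm := ogd_mem (grad := grad) (η := η) hWclosed hWconvex hw₁ t
  rw [norm_sub_rev]
  refine (norm_proj_sub_le hWclosed hWconvex _ hm).trans ?_
  rw [sub_sub_cancel_left, norm_neg, norm_smul, Real.norm_of_nonneg hη]
  gcongr
  exact hgradbound t ht _ hm

/-- The usual telescoping of ‖w_t - u‖². Each step moves by at most ηG, so switching adds ληG² per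
round to the usual ηG²/2. -/
lemma ogd_regret_le (hWclosed : IsClosed W) (hWconvex : Convex ℝ W)
    (hfconvex : ∀ t < T, ConvexOn ℝ W (f t))
    (hgrad : ∀ t < T, ∀ x ∈ W, HasGradientWithinAt (f t) (grad t x) W x)
    (hgradbound : ∀ t < T, ∀ x ∈ W, ‖grad t x‖ ≤ G)
    (hdiam : ∀ x ∈ W, ∀ y ∈ W, ‖x - y‖ ≤ D) (hlam : 0 ≤ lam) (hG : 0 ≤ G)
    (hw₁ : w₁ ∈ W) (hη : 0 < η) {u : E} (hu : u ∈ W) {r q : ℕ} (hrq : r ≤ q) (hqT : q ≤ T) :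
    ∑ t ∈ Finset.Ico r q, (roundLoss f lam G (ogd W grad η w₁) t - f t u)
      ≤ D ^ 2 / (2 * η) + ((q : ℝ) - r) * ((1 + 2 * lam) * η * G ^ 2 / 2) := by
  set w := ogd W grad η w₁ with hw
  have hmem : ∀ t, w t ∈ W := ogd_mem hWclosed hWconvex hw₁
  have hstep : ∀ t ∈ Finset.Ico r q, roundLoss f lam G w t - f t u
      ≤ (‖w t - u‖ ^ 2 - ‖w (t + 1) - u‖ ^ 2) / (2 * η) + (1 + 2 * lam) * η * G ^ 2 / 2 := by
    intro t ht
    have ht' : t < T := by have := (Finset.mem_Ico.1 ht).2; omega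
    have h1 := ConvexOn.le_inner_gradient (hfconvex t ht') (hgrad t ht' _ (hmem t)) (hmem t) hu
    have h2 : ‖w (t + 1) - u‖ ≤ ‖w t - η • grad t (w t) - u‖ :=
      norm_proj_sub_le hWclosed hWconvex _ hu
    have h3 : ‖w t - η • grad t (w t) - u‖ ^ 2
        = ‖w t - u‖ ^ 2 - 2 * (η * inner ℝ (grad t (w t)) (w t - u)) + (η * ‖grad t (w t)‖) ^ 2 := by
      rw [sub_right_comm, norm_sub_sq_real, real_inner_comm, real_inner_smul_left, norm_smul,
        Real.norm_of_nonneg hη.le]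
    have h4 : ‖w (t + 1) - u‖ ^ 2 ≤ ‖w t - η • grad t (w t) - u‖ ^ 2 := by gcongr
    have h5 : (η * ‖grad t (w t)‖) ^ 2 ≤ (η * G) ^ 2 := by
      gcongr; exact hgradbound t ht' _ (hmem t)
    have h6 : inner ℝ (grad t (w t)) (w t - u)
        ≤ (‖w t - u‖ ^ 2 - ‖w (t + 1) - u‖ ^ 2) / (2 * η) + η * G ^ 2 / 2 := by
      rw [div_add_div _ _ (by positivity) (by norm_num), le_div_iff₀ (by positivity)]
      linarith
    have h7 : lam * G * ‖w t - w (t + 1)‖ ≤ lam * G * (η * G) := by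
      gcongr
      exact norm_ogd_sub_succ_le hWclosed hWconvex hgradbound hw₁ hη.le ht'
    unfold roundLoss
    linarith
  refine (Finset.sum_le_sum hstep).trans ?_
  rw [Finset.sum_add_distrib, ← Finset.sum_div, Finset.sum_const, Nat.card_Ico, nsmul_eq_mul,
    Nat.cast_sub hrq]
  have htel := Finset.sum_Ico_sub (fun t => -‖w t - u‖ ^ 2) hrq
  have h8 : ∑ t ∈ Finset.Ico r q, (‖w t - u‖ ^ 2 - ‖w (t + 1) - u‖ ^ 2) ≤ D ^ 2 := by
    have : ∀ t, ‖w t - u‖ ^ 2 - ‖w (t + 1) - u‖ ^ 2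
      = -‖w (t + 1) - u‖ ^ 2 - -‖w t - u‖ ^ 2 := fun t => by ring
    simp_rw [this]
    rw [htel]
    have h9 : ‖w r - u‖ ^ 2 ≤ D ^ 2 := by gcongr; exact hdiam _ (hmem r) _ hu
    nlinarith [sq_nonneg ‖w q - u‖]
  gcongr

end OGD

/-! ### Combiner against each of its two learners. -/

section Combiner

variable {W : Set E} {f : ℕ → E → ℝ} {T : ℕ} {lam G D n Z : ℝ} {u v : ℕ → E}

/-- Hitting costs differ by at most GD and each switching cost is at most 2GD, which is why M = 2
normalises by 3GD. -/
lemma abs_lossDiff_div_le (hG : 0 < G) (hD : 0 < D) (hlam : 0 ≤ lam)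
    (hfD : ∀ t < T, ∀ x ∈ W, ∀ y ∈ W, f t x - f t y ≤ G * D)
    (hu : ∀ t, u t ∈ W) (hv : ∀ t, v t ∈ W)
    (hum : ∀ t < T, lam * ‖u t - u (t + 1)‖ ≤ 2 * D)
    (hvm : ∀ t < T, lam * ‖v t - v (t + 1)‖ ≤ 2 * D) {t : ℕ} (ht : t < T) :
    |lossDiff f lam G D 2 u v t / max (√lam) 1| ≤ 1 / max (√lam) 1 := by
  have hm : 0 < max (√lam) 1 := lt_max_of_lt_right one_pos
  rw [abs_div, abs_of_pos hm]
  gcongr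
  rw [lossDiff, abs_div, abs_of_pos (by positivity : 0 < (1 + 2) * G * D),
    div_le_one (by positivity)]
  have h1 := hfD t ht _ (hu t) _ (hv t)
  have h2 := hfD t ht _ (hv t) _ (hu t)
  have h3 := mul_le_mul_of_nonneg_left (hum t ht) hG.le
  have h4 := mul_le_mul_of_nonneg_left (hvm t ht) hG.le
  have h5 : 0 ≤ G * (lam * ‖u t - u (t + 1)‖) := by positivity
  have h6 : 0 ≤ G * (lam * ‖v t - v (t + 1)‖) := by positivity
  unfold roundLoss
  rw [abs_le]
  constructor <;> linarith

lemma combinerWeight_mem (f : ℕ → E → ℝ) (lam G D M n Z : ℝ) (u v : ℕ → E) (t : ℕ) :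
    combinerWeight f lam G D M n Z u v t ∈ Set.Icc 0 1 :=
  ⟨conf_nonneg _ _ _, conf_le_one _ _ _⟩

lemma combiner_mem (hW : Convex ℝ W) (hu : ∀ t, u t ∈ W) (hv : ∀ t, v t ∈ W) (M : ℝ) (t : ℕ) :
    combiner f lam G D M n Z u v t ∈ W := by
  obtain ⟨h0, h1⟩ := combinerWeight_mem f lam G D M n Z u v t
  exact hW (hu t) (hv t) (by linarith) h0 (by ring)

lemma norm_combiner_sub_succ_le (hdiam : ∀ x ∈ W, ∀ y ∈ W, ‖x - y‖ ≤ D)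
    (hu : ∀ t, u t ∈ W) (hv : ∀ t, v t ∈ W) (M : ℝ) (t : ℕ) :
    ‖combiner f lam G D M n Z u v t - combiner f lam G D M n Z u v (t + 1)‖ ≤
      (1 - combinerWeight f lam G D M n Z u v t) * ‖u t - u (t + 1)‖
        + combinerWeight f lam G D M n Z u v t * ‖v t - v (t + 1)‖
        + |combinerWeight f lam G D M n Z u v t - combinerWeight f lam G D M n Z u v (t + 1)| * D := by
  obtain ⟨h0, h1⟩ := combinerWeight_mem f lam G D M n Z u v t
  unfold combiner
  set p := combinerWeight f lam G D M n Z u v t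
  set p' := combinerWeight f lam G D M n Z u v (t + 1)
  have e : (1 - p) • u t + p • v t - ((1 - p') • u (t + 1) + p' • v (t + 1))
      = (1 - p) • (u t - u (t + 1)) + p • (v t - v (t + 1))
        + (p - p') • (v (t + 1) - u (t + 1)) := by module
  rw [e]
  refine (norm_add₃_le).trans ?_
  rw [norm_smul, norm_smul, norm_smul, Real.norm_of_nonneg h0,
    Real.norm_of_nonneg (sub_nonneg.2 h1), Real.norm_eq_abs]
  gcongr
  exact hdiam _ (hv _) _ (hu _)

/-- Convexity handles the hitting cost and the learners' own movement. The change of weight costs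
λGD|Δp| ≤ 3GDΛ · (Λ/3)|Δp|, exactly the penalty carried by the reward bounds. -/
lemma roundLoss_combiner_le (hG : 0 < G) (hD : 0 < D) (hlam : 0 ≤ lam)
    (hfconvex : ∀ t < T, ConvexOn ℝ W (f t))
    (hdiam : ∀ x ∈ W, ∀ y ∈ W, ‖x - y‖ ≤ D)
    (hu : ∀ t, u t ∈ W) (hv : ∀ t, v t ∈ W) {t : ℕ} (ht : t < T) :
    roundLoss f lam G (combiner f lam G D 2 n Z u v) t ≤ roundLoss f lam G u t
      - 3 * G * D * max (√lam) 1 * (combinerWeight f lam G D 2 n Z u v t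
          * (lossDiff f lam G D 2 u v t / max (√lam) 1)
        - max (√lam) 1 / 3 * |combinerWeight f lam G D 2 n Z u v t
          - combinerWeight f lam G D 2 n Z u v (t + 1)|) := by
  have hm : 0 < max (√lam) 1 := lt_max_of_lt_right one_pos
  have hlm : lam ≤ max (√lam) 1 ^ 2 := by
    rw [← Real.sqrt_le_left hm.le]
    exact le_max_left _ _
  obtain ⟨h0, h1⟩ := combinerWeight_mem f lam G D 2 n Z u v t
  have hmove := norm_combiner_sub_succ_le (f := f) (lam := lam) (G := G) (n := n) (Z := Z)
    hdiam hu hv 2 t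
  have hconv : f t (combiner f lam G D 2 n Z u v t) ≤
      (1 - combinerWeight f lam G D 2 n Z u v t) * f t (u t)
        + combinerWeight f lam G D 2 n Z u v t * f t (v t) :=
    (hfconvex t ht).2 (hu t) (hv t) (by linarith) h0 (by ring)
  have hb : combinerWeight f lam G D 2 n Z u v t * (roundLoss f lam G u t - roundLoss f lam G v t)
      = 3 * G * D * max (√lam) 1 * (combinerWeight f lam G D 2 n Z u v t
          * (lossDiff f lam G D 2 u v t / max (√lam) 1)) := by
    unfold lossDiff
    field_simp
    ring
  rw [mul_sub, ← hb]
  set p := combinerWeight f lam G D 2 n Z u v t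
  set p' := combinerWeight f lam G D 2 n Z u v (t + 1)
  have h2 := mul_le_mul_of_nonneg_left hmove (by positivity : 0 ≤ lam * G)
  have h3 : lam * (G * (|p - p'| * D)) ≤ max (√lam) 1 ^ 2 * (G * (|p - p'| * D)) := by gcongr
  unfold roundLoss
  linarith

section Regret

variable (hG : 0 < G) (hD : 0 < D) (hlam : 0 ≤ lam)
  (hfconvex : ∀ t < T, ConvexOn ℝ W (f t))
  (hdiam : ∀ x ∈ W, ∀ y ∈ W, ‖x - y‖ ≤ D)
  (hfD : ∀ t < T, ∀ x ∈ W, ∀ y ∈ W, f t x - f t y ≤ G * D)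
  (hu : ∀ t, u t ∈ W) (hv : ∀ t, v t ∈ W)
  (hum : ∀ t < T, lam * ‖u t - u (t + 1)‖ ≤ 2 * D)
  (hvm : ∀ t < T, lam * ‖v t - v (t + 1)‖ ≤ 2 * D)
  (hZ : 0 < Z) (hL : 1 ≤ Real.log (1 / Z))
  (hn : 32 * max (√lam) 1 ^ 2 * Real.log (1 / Z) ≤ n)
include hG hD hlam hfD hu hv hum hvm hZ hL hn

lemma mul_norm_combiner_sub_succ_le (hdiam : ∀ x ∈ W, ∀ y ∈ W, ‖x - y‖ ≤ D)
    (hnZ : n * Z ≤ 1) {c : ℝ}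
    (huc : ∀ t < T, lam * ‖u t - u (t + 1)‖ ≤ c) (hvc : ∀ t < T, lam * ‖v t - v (t + 1)‖ ≤ c)
    {t : ℕ} (ht : t < T) :
    lam * ‖combiner f lam G D 2 n Z u v t - combiner f lam G D 2 n Z u v (t + 1)‖
      ≤ c + max (√lam) 1 * confRate n Z * D := by
  have hm : 1 ≤ max (√lam) 1 := le_max_right _ _
  have hlm : lam ≤ max (√lam) 1 ^ 2 := by
    rw [← Real.sqrt_le_left (by linarith)]
    exact le_max_left _ _
  have hb := fun t (ht : t < T) => abs_lossDiff_div_le hG hD hlam hfD hu hv hum hvm ht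
  obtain ⟨h0, h1⟩ := combinerWeight_mem f lam G D 2 n Z u v t
  have hmove := norm_combiner_sub_succ_le (f := f) (lam := lam) (G := G) (n := n) (Z := Z)
    hdiam hu hv 2 t
  have h2 : max (√lam) 1 ^ 2 * |combinerWeight f lam G D 2 n Z u v t
      - combinerWeight f lam G D 2 n Z u v (t + 1)| ≤ max (√lam) 1 * confRate n Z :=
    dnpPredict_sub_le hm hZ hL hn hb hnZ ht
  set p := combinerWeight f lam G D 2 n Z u v t
  set p' := combinerWeight f lam G D 2 n Z u v (t + 1)
  have h3 := mul_le_mul_of_nonneg_left hmove hlam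
  have h4 := mul_le_mul_of_nonneg_left (huc t ht) (sub_nonneg.2 h1)
  have h5 := mul_le_mul_of_nonneg_left (hvc t ht) h0
  have h6 : lam * (|p - p'| * D) ≤ max (√lam) 1 ^ 2 * (|p - p'| * D) := by gcongr
  have h7 := mul_le_mul_of_nonneg_right h2 hD.le
  linarith

include hfconvex hdiam

lemma sum_roundLoss_combiner_le_first {r q : ℕ} (hrq : r ≤ q) (hqT : q ≤ T) :
    ∑ t ∈ Finset.Ico r q, roundLoss f lam G (combiner f lam G D 2 n Z u v) t
      ≤ ∑ t ∈ Finset.Ico r q, roundLoss f lam G u t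
        + 3 * G * D * max (√lam) 1 * (threshold n Z + 1 + ((q : ℝ) - r) * Z) := by
  have hm : 1 ≤ max (√lam) 1 := le_max_right _ _
  have hb := fun t (ht : t < T) => abs_lossDiff_div_le hG hD hlam hfD hu hv hum hvm ht
  have h := reward_ge hm hZ hL hn hb hrq hqT
  have h1 := Finset.sum_le_sum fun t (ht : t ∈ Finset.Ico r q) =>
    roundLoss_combiner_le (n := n) (Z := Z) hG hD hlam hfconvex hdiam hu hv
      (lt_of_lt_of_le (Finset.mem_Ico.1 ht).2 hqT)
  rw [Finset.sum_sub_distrib, ← Finset.mul_sum] at h1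
  have h2 := mul_le_mul_of_nonneg_left h (by positivity : 0 ≤ 3 * G * D * max (√lam) 1)
  simp only [combinerWeight] at h1
  linarith

lemma sum_roundLoss_combiner_le_second {r q : ℕ} (hrq : r ≤ q) (hqT : q ≤ T) :
    ∑ t ∈ Finset.Ico r q, roundLoss f lam G (combiner f lam G D 2 n Z u v) t
      ≤ ∑ t ∈ Finset.Ico r q, roundLoss f lam G v t
        + 3 * G * D * max (√lam) 1 * (threshold n Z + 1
          + ((q : ℝ) - r) * ((threshold n Z + 1) / n + Z)) := by
  have hm : 1 ≤ max (√lam) 1 := le_max_right _ _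
  have hb := fun t (ht : t < T) => abs_lossDiff_div_le hG hD hlam hfD hu hv hum hvm ht
  have h := reward_sub_ge hm hZ hL hn hb hrq hqT
  have h1 := Finset.sum_le_sum fun t (ht : t ∈ Finset.Ico r q) =>
    roundLoss_combiner_le (n := n) (Z := Z) hG hD hlam hfconvex hdiam hu hv
      (lt_of_lt_of_le (Finset.mem_Ico.1 ht).2 hqT)
  -- The bit is the scaled loss difference, so subtracting it from the reward changes the comparator
  -- from u to v.
  have h3 : ∀ t, roundLoss f lam G u t = roundLoss f lam G v t
      + 3 * G * D * max (√lam) 1 * (lossDiff f lam G D 2 u v t / max (√lam) 1) := fun t => by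
    unfold lossDiff
    field_simp
    ring
  have h4 : ∀ t, roundLoss f lam G u t
      - 3 * G * D * max (√lam) 1 * (combinerWeight f lam G D 2 n Z u v t
          * (lossDiff f lam G D 2 u v t / max (√lam) 1)
        - max (√lam) 1 / 3 * |combinerWeight f lam G D 2 n Z u v t
          - combinerWeight f lam G D 2 n Z u v (t + 1)|) = roundLoss f lam G v t
      - 3 * G * D * max (√lam) 1 * (combinerWeight f lam G D 2 n Z u v t
          * (lossDiff f lam G D 2 u v t / max (√lam) 1) - lossDiff f lam G D 2 u v t / max (√lam) 1
        - max (√lam) 1 / 3 * |combinerWeight f lam G D 2 n Z u v t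
          - combinerWeight f lam G D 2 n Z u v (t + 1)|) := fun t => by
    rw [h3]; ring
  simp_rw [h4] at h1
  rw [Finset.sum_sub_distrib, ← Finset.mul_sum] at h1
  have h2 := mul_le_mul_of_nonneg_left h (by positivity : 0 ≤ 3 * G * D * max (√lam) 1)
  simp only [combinerWeight] at h1
  linarith

end Regret

end Combiner

/-! ### The dyadic interval lengths. -/

lemma intervalLen_one (T : ℕ) : intervalLen T 1 = T := by simp [intervalLen]

lemma intervalLen_succ (T i : ℕ) : intervalLen T (i + 1) = intervalLen T i / 2 := by
  unfold intervalLen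
  rw [show (1 : ℤ) - ((i + 1 : ℕ) : ℤ) = (1 - (i : ℤ)) - 1 by push_cast; ring,
    zpow_sub_one₀ two_ne_zero]
  ring

lemma intervalLen_pos {T : ℕ} (hT : 0 < T) (i : ℕ) : 0 < intervalLen T i := by
  unfold intervalLen; positivity

lemma intervalLen_antitone (T : ℕ) : Antitone (intervalLen T) := by
  refine antitone_nat_of_succ_le fun i => ?_
  rw [intervalLen_succ]
  have : 0 ≤ intervalLen T i := by unfold intervalLen; positivity
  linarith

lemma exists_intervalLen {T : ℕ} {τ : ℝ} (hτ : τ ≤ T) {k : ℕ} (hk : intervalLen T (k + 1) < τ) :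
    ∃ i ≤ k, τ ≤ intervalLen T (i + 1) ∧ intervalLen T (i + 1) ≤ 2 * τ := by
  induction k with
  | zero => rw [zero_add, intervalLen_one] at hk; linarith
  | succ k ih =>
    rcases lt_or_ge (intervalLen T (k + 1)) τ with h | h
    · obtain ⟨i, hi, h'⟩ := ih h
      exact ⟨i, by omega, h'⟩
    · refine ⟨k, by omega, h, ?_⟩
      rw [intervalLen_succ] at hk
      linarith

lemma sqrt_two_bounds : (141 : ℝ) / 100 ≤ √2 ∧ √2 ≤ 1415 / 1000 :=
  ⟨Real.le_sqrt_of_sq_le (by norm_num), Real.sqrt_le_iff.2 (by norm_num)⟩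

lemma confRate_intervalLen_succ (T i : ℕ) (Z : ℝ) :
    confRate (intervalLen T (i + 1)) Z = √2 * confRate (intervalLen T i) Z := by
  rw [confRate, confRate, ← Real.sqrt_mul (by norm_num), intervalLen_succ]
  congr 1
  rw [div_div_eq_mul_div]
  ring

lemma le_sq_max_sqrt (lam : ℝ) : lam ≤ max (√lam) 1 ^ 2 := by
  rw [← Real.sqrt_le_left (zero_le_one.trans (le_max_right _ _))]
  exact le_max_left _ _

lemma stepSize_mul {T : ℕ} {lam G D : ℝ} (hG : 0 < G) (i : ℕ) :
    stepSize T lam G D i * G = D * √(1 / ((1 + 2 * lam) * intervalLen T i)) := by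
  unfold stepSize
  field_simp

lemma threshold_add_one_le {n Z Lam : ℝ} (hLam : 1 ≤ Lam) (hZ : 0 < Z)
    (hL : 1 ≤ Real.log (1 / Z)) (hn : 32 * Lam ^ 2 * Real.log (1 / Z) ≤ n) :
    threshold n Z + 1 ≤ 42 / 10 * (√n * √(Real.log (1 / Z))) := by
  have hn1 := le_of_large hLam hL hn
  have h := threshold_le hn1 hZ hL
  rw [Real.sqrt_mul (by linarith)] at h
  have h1 : 5 ≤ √n := Real.le_sqrt_of_sq_le (by linarith)
  have h2 : 1 ≤ √(Real.log (1 / Z)) := Real.one_le_sqrt.2 hL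
  nlinarith

/-! ### Movement and loss along the chain of combiners. -/

section Chain

variable [CompleteSpace E] {W : Set E} {f : ℕ → E → ℝ} {grad : ℕ → E → E} {T : ℕ}
  {lam G D Z : ℝ} {w₁ : ℕ → E} {K : ℕ}
  (hWclosed : IsClosed W) (hWconvex : Convex ℝ W) (hw₁ : ∀ i, w₁ i ∈ W)
include hWclosed hWconvex hw₁

lemma expert_mem (i t : ℕ) : expert W grad T lam G D w₁ i t ∈ W :=
  ogd_mem hWclosed hWconvex (hw₁ i) t

lemma chain_mem (M : ℝ) (i t : ℕ) : chain W f grad T lam G D M Z w₁ (i + 1) t ∈ W := by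
  induction i generalizing t with
  | zero => exact expert_mem hWclosed hWconvex hw₁ 1 t
  | succ i ih => exact combiner_mem hWconvex ih (expert_mem hWclosed hWconvex hw₁ _) M t

variable (hlam : 0 ≤ lam) (hG : 0 < G) (hD : 0 < D)
  (hfconvex : ∀ t < T, ConvexOn ℝ W (f t))
  (hgradbound : ∀ t < T, ∀ x ∈ W, ‖grad t x‖ ≤ G)
  (hdiam : ∀ x ∈ W, ∀ y ∈ W, ‖x - y‖ ≤ D)
  (hfD : ∀ t < T, ∀ x ∈ W, ∀ y ∈ W, f t x - f t y ≤ G * D)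
  (hZ : Z = 1 / (T : ℝ)) (hL : 1 ≤ Real.log (1 / Z))
  (hK : 32 * max (√lam) 1 ^ 2 * Real.log (1 / Z) ≤ intervalLen T K)
include hlam hG hD hgradbound

lemma norm_expert_sub_succ_le (i : ℕ) {t : ℕ} (ht : t < T) :
    lam * ‖expert W grad T lam G D w₁ i t - expert W grad T lam G D w₁ i (t + 1)‖
      ≤ D * (lam * √(1 / ((1 + 2 * lam) * intervalLen T i))) := by
  have hη : 0 ≤ stepSize T lam G D i := by unfold stepSize; positivity
  have h := norm_ogd_sub_succ_le hWclosed hWconvex hgradbound (hw₁ i) hη ht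
  rw [stepSize_mul hG] at h
  calc _ ≤ lam * (D * √(1 / ((1 + 2 * lam) * intervalLen T i))) := by gcongr; exact h
    _ = _ := by ring

include hL hK in
lemma norm_expert_sub_succ_le_of_large {i : ℕ} (hi : i ≤ K) {t : ℕ} (ht : t < T) :
    lam * ‖expert W grad T lam G D w₁ i t - expert W grad T lam G D w₁ i (t + 1)‖ ≤ D / 8 := by
  refine (norm_expert_sub_succ_le hWclosed hWconvex hw₁ hlam hG hD hgradbound i ht).trans ?_
  have hn := hK.trans (intervalLen_antitone T hi)
  set n := intervalLen T i
  have hm : 1 ≤ max (√lam) 1 := le_max_right _ _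
  have hl := le_sq_max_sqrt lam
  have hn1 := le_of_large hm hL hn
  have hnl : 32 * lam ≤ n := by nlinarith [sq_nonneg (max (√lam) 1)]
  have : lam * √(1 / ((1 + 2 * lam) * n)) ≤ 1 / 8 := by
    refine abs_le_of_sq_le_sq' ?_ (by norm_num) |>.2
    have hp : 0 < (1 + 2 * lam) * n := by positivity
    rw [mul_pow, Real.sq_sqrt (by positivity), mul_one_div, div_le_iff₀ hp]
    nlinarith
  nlinarith

include hZ hL hK hdiam hfD

/-- The induction is a bootstrap: the bound at one level is below 2D, which keeps the next level's
bits in range. With y = Λ · `confRate` at the old level, the next one adds √2 y, and 4y + √2 y ≤ 4√2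
y reproduces the bound. -/
lemma norm_chain_sub_succ_le {i : ℕ} (hi : i + 1 ≤ K) {t : ℕ} (ht : t < T) :
    lam * ‖chain W f grad T lam G D 2 Z w₁ (i + 1) t
      - chain W f grad T lam G D 2 Z w₁ (i + 1) (t + 1)‖
      ≤ D * (1 / 8 + 4 * (max (√lam) 1 * confRate (intervalLen T (i + 1)) Z)) := by
  have hT0 : 0 < T := by omega
  have hZ0 : 0 < Z := by rw [hZ]; positivity
  have hm : 1 ≤ max (√lam) 1 := le_max_right _ _
  have hexp : ∀ j ≤ K, ∀ t < T, _ := fun j hj t ht =>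
    norm_expert_sub_succ_le_of_large (i := j) hWclosed hWconvex hw₁ hlam hG hD hgradbound hL hK hj ht
  have hq0 : ∀ n, 0 ≤ max (√lam) 1 * confRate n Z := fun n =>
    mul_nonneg (by linarith) (Real.sqrt_nonneg _)
  induction i generalizing t with
  | zero =>
    refine (hexp 1 hi t ht).trans ?_
    have := mul_nonneg hD.le (hq0 (intervalLen T (0 + 1)))
    linarith
  | succ i ih =>
    have hn := hK.trans (intervalLen_antitone T hi)
    have hn' := hK.trans (intervalLen_antitone T (show i + 1 ≤ K by omega))
    have hq := mul_confRate_le hm hL hn'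
    have hprev : D * (1 / 8 + 4 * (max (√lam) 1 * confRate (intervalLen T (i + 1)) Z)) ≤ 2 * D := by
      nlinarith
    have hnZ : intervalLen T (i + 1 + 1) * Z ≤ 1 := by
      have := intervalLen_antitone T (show 1 ≤ i + 1 + 1 by omega)
      rw [intervalLen_one] at this
      rw [hZ, mul_one_div, div_le_one (by positivity)]
      exact this
    have h := mul_norm_combiner_sub_succ_le (n := intervalLen T (i + 1 + 1)) (Z := Z)
      (c := D * (1 / 8 + 4 * (max (√lam) 1 * confRate (intervalLen T (i + 1)) Z)))
      hG hD hlam hfD (chain_mem hWclosed hWconvex hw₁ 2 i)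
      (expert_mem hWclosed hWconvex hw₁ (i + 2))
      (fun t ht => (ih (by omega) ht).trans hprev)
      (fun t ht => (hexp _ hi t ht).trans (by linarith)) hZ0 hL hn hdiam hnZ
      (fun t ht => ih (by omega) ht)
      (fun t ht => (hexp _ hi t ht).trans (by
        have := mul_nonneg hD.le (hq0 (intervalLen T (i + 1)))
        linarith)) ht
    refine h.trans ?_
    rw [confRate_intervalLen_succ T (i + 1), mul_left_comm (max (√lam) 1)]
    have h0 := mul_nonneg hD.le (hq0 (intervalLen T (i + 1)))
    set y := max (√lam) 1 * confRate (intervalLen T (i + 1)) Z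
    have := sqrt_two_bounds.1
    nlinarith

lemma norm_chain_sub_succ_le_two {i : ℕ} (hi : i + 1 ≤ K) {t : ℕ} (ht : t < T) :
    lam * ‖chain W f grad T lam G D 2 Z w₁ (i + 1) t
      - chain W f grad T lam G D 2 Z w₁ (i + 1) (t + 1)‖ ≤ 2 * D := by
  have hm : 1 ≤ max (√lam) 1 := le_max_right _ _
  have hq := mul_confRate_le hm hL (hK.trans (intervalLen_antitone T hi))
  refine (norm_chain_sub_succ_le hWclosed hWconvex hw₁ hlam hG hD hgradbound hdiam hfD hZ hL hK
    hi ht).trans ?_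
  nlinarith

include hfconvex

/-- Passing to a finer level of the chain costs little on every interval. -/
lemma sum_roundLoss_chain_le {r q : ℕ} (hrq : r < q) (hqT : q ≤ T) (i k : ℕ)
    (hk : i + k + 1 ≤ K) :
    ∑ t ∈ Finset.Ico r q, roundLoss f lam G (chain W f grad T lam G D 2 Z w₁ (i + k + 1)) t
      ≤ ∑ t ∈ Finset.Ico r q, roundLoss f lam G (chain W f grad T lam G D 2 Z w₁ (i + 1)) t
        + 3 * G * D * max (√lam) 1 * (105 / 10 * √(Real.log (1 / Z)) *
          (√(intervalLen T (i + 1)) - √(intervalLen T (i + k + 1))) + k * (((q : ℝ) - r) * Z)) := by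
  have hT0 : 0 < T := by omega
  have hZ0 : 0 < Z := by rw [hZ]; positivity
  have hm : 1 ≤ max (√lam) 1 := le_max_right _ _
  induction k with
  | zero => simp
  | succ k ih =>
    have hn := hK.trans (intervalLen_antitone T hk)
    have h := sum_roundLoss_combiner_le_first (n := intervalLen T (i + k + 1 + 1)) (Z := Z)
      hG hD hlam hfconvex hdiam hfD (chain_mem hWclosed hWconvex hw₁ 2 (i + k))
      (expert_mem hWclosed hWconvex hw₁ (i + k + 2))
      (fun t ht => norm_chain_sub_succ_le_two hWclosed hWconvex hw₁ hlam hG hD hgradbound hdiam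
        hfD hZ hL hK (by omega) ht)
      (fun t ht => (norm_expert_sub_succ_le_of_large hWclosed hWconvex hw₁ hlam hG hD hgradbound
        hL hK hk ht).trans (by linarith)) hZ0 hL hn hrq.le hqT
    refine h.trans ((add_le_add_left (ih (by omega)) _).trans ?_)
    rw [add_assoc (∑ t ∈ _, _), ← mul_add]
    have hU := threshold_add_one_le hm hZ0 hL hn
    have hs : √(intervalLen T (i + k + 1)) = √2 * √(intervalLen T (i + k + 1 + 1)) := by
      rw [← Real.sqrt_mul (by norm_num), intervalLen_succ T (i + k + 1)]
      congr 1; ring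
    have h1 := sqrt_two_bounds.1
    -- One more level costs 4.2 N S, with N, S as below; 10.5(√2 - 1) ≥ 4.2 lets the difference of
    -- square roots absorb it.
    refine add_le_add le_rfl (mul_le_mul_of_nonneg_left ?_ (by positivity))
    rw [← add_assoc i k 1] at hU ⊢
    push_cast
    rw [hs]
    set N := √(intervalLen T (i + k + 1 + 1))
    set S := √(Real.log (1 / Z))
    have h0 : 0 ≤ N * S := by positivity
    nlinarith

/-- On every interval a level of the chain competes with its own expert. -/
lemma sum_roundLoss_chain_le_expert {r q : ℕ} (hrq : r < q) (hqT : q ≤ T) {i : ℕ}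
    (hi : i + 1 ≤ K) :
    ∑ t ∈ Finset.Ico r q, roundLoss f lam G (chain W f grad T lam G D 2 Z w₁ (i + 1)) t
      ≤ ∑ t ∈ Finset.Ico r q, roundLoss f lam G (expert W grad T lam G D w₁ (i + 1)) t
        + 3 * G * D * max (√lam) 1 * (42 / 10 * √(Real.log (1 / Z)) *
          (√(intervalLen T (i + 1)) + ((q : ℝ) - r) / √(intervalLen T (i + 1)))
          + ((q : ℝ) - r) * Z) := by
  have hT0 : 0 < T := by omega
  have hZ0 : 0 < Z := by rw [hZ]; positivity
  have hm : 1 ≤ max (√lam) 1 := le_max_right _ _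
  have hτ : (0 : ℝ) < (q : ℝ) - r := sub_pos.2 (by exact_mod_cast hrq)
  cases i with
  | zero =>
    -- The first level is its own expert, so only the sign of the error term matters.
    refine le_add_of_nonneg_right ?_
    positivity
  | succ i =>
    have hn := hK.trans (intervalLen_antitone T hi)
    have h := sum_roundLoss_combiner_le_second (n := intervalLen T (i + 1 + 1)) (Z := Z)
      hG hD hlam hfconvex hdiam hfD (chain_mem hWclosed hWconvex hw₁ 2 i)
      (expert_mem hWclosed hWconvex hw₁ (i + 2))
      (fun t ht => norm_chain_sub_succ_le_two hWclosed hWconvex hw₁ hlam hG hD hgradbound hdiam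
        hfD hZ hL hK (by omega) ht)
      (fun t ht => (norm_expert_sub_succ_le_of_large hWclosed hWconvex hw₁ hlam hG hD hgradbound
        hL hK hi ht).trans (by linarith)) hZ0 hL hn hrq.le hqT
    refine h.trans ?_
    have hU := threshold_add_one_le hm hZ0 hL hn
    have hn0 : 0 < intervalLen T (i + 1 + 1) := intervalLen_pos hT0 _
    have h1 : (threshold (intervalLen T (i + 1 + 1)) Z + 1) / intervalLen T (i + 1 + 1)
        ≤ 42 / 10 * √(Real.log (1 / Z)) / √(intervalLen T (i + 1 + 1)) := by
      rw [div_le_div_iff₀ hn0 (Real.sqrt_pos.2 hn0)]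
      have := mul_le_mul_of_nonneg_right hU (Real.sqrt_nonneg (intervalLen T (i + 1 + 1)))
      refine this.trans_eq ?_
      nth_rewrite 3 [← Real.mul_self_sqrt hn0.le]
      ring
    have h2 := mul_le_mul_of_nonneg_left h1 hτ.le
    have e : ((q : ℝ) - r) * (42 / 10 * √(Real.log (1 / Z)) / √(intervalLen T (i + 1 + 1)))
      = 42 / 10 * √(Real.log (1 / Z)) * (((q : ℝ) - r) / √(intervalLen T (i + 1 + 1))) := by ring
    refine add_le_add le_rfl (mul_le_mul_of_nonneg_left ?_ (by positivity))
    linarith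

end Chain

/-! ### The number of experts. -/

section NumExperts

variable {T : ℕ} {lam Z : ℝ}

lemma sq_max_sqrt (hlam : 0 ≤ lam) : max (√lam) 1 ^ 2 = max lam 1 := by
  rcases le_total lam 1 with h | h
  · rw [max_eq_right h, max_eq_right (Real.sqrt_le_one.2 h), one_pow]
  · rw [max_eq_left h, max_eq_left (Real.one_le_sqrt.2 h), Real.sq_sqrt hlam]

/-- With `k + 1` experts the shortest interval length is of order `max λ 1 * log (1 / Z)`. -/
lemma exists_numExperts (hT : 0 < T) (hlam : 0 ≤ lam) (hL : 1 ≤ Real.log (1 / Z)) :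
    ∃ k, numExperts T lam Z = k + 1 ∧
      intervalLen T (k + 1) ≤ 64 * max (√lam) 1 ^ 2 * Real.log (1 / Z) ∧
      (k = 0 ∨ 32 * max (√lam) 1 ^ 2 * Real.log (1 / Z) ≤ intervalLen T (k + 1) ∧
        (k : ℝ) ≤ Real.logb 2 T) := by
  have hT0 : (0 : ℝ) < T := by positivity
  rw [sq_max_sqrt hlam, numExperts]
  have hm : 1 ≤ max lam 1 := le_max_right _ _
  set c := 32 * max lam 1 * Real.log (1 / Z) with hc
  have hc1 : 1 ≤ c := by nlinarith
  set y := Real.logb 2 (T / c) with hy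
  have hpow : ∀ m : ℤ, (2 : ℝ) ^ (m : ℝ) = 2 ^ m := fun m => Real.rpow_intCast 2 m
  have hlen : ∀ k : ℕ, intervalLen T (k + 1) = T / 2 ^ (k : ℤ) := fun k => by
    unfold intervalLen
    rw [show (1 : ℤ) - ((k + 1 : ℕ) : ℤ) = -(k : ℤ) by push_cast; ring, zpow_neg, div_eq_mul_inv]
  rcases le_or_gt ⌊y⌋ 0 with h | h
  · refine ⟨0, by rw [max_eq_left (by omega)]; rfl, ?_, .inl rfl⟩
    have hlt : y < 1 := by
      have := Int.lt_floor_add_one y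
      have h' : (⌊y⌋ : ℝ) ≤ 0 := by exact_mod_cast h
      linarith
    rw [hy, Real.logb_lt_iff_lt_rpow (by norm_num) (by positivity), Real.rpow_one,
      div_lt_iff₀ (by linarith)] at hlt
    rw [zero_add, intervalLen_one]
    linarith
  · obtain ⟨k, hk⟩ := Int.eq_ofNat_of_zero_le h.le
    refine ⟨k, by rw [hk, max_eq_right (by omega)]; rfl, ?_, .inr ⟨?_, ?_⟩⟩
    · have hlt := Int.lt_floor_add_one y
      rw [hk, hy, Real.logb_lt_iff_lt_rpow (by norm_num) (by positivity),
        div_lt_iff₀ (by linarith), Real.rpow_add (by norm_num), hpow, Real.rpow_one] at hlt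
      rw [hlen, div_le_iff₀ (by positivity)]
      linarith
    · have hle := Int.floor_le y
      rw [hk, hy, Real.le_logb_iff_rpow_le (by norm_num) (by positivity),
        le_div_iff₀ (by linarith), hpow] at hle
      rw [hlen, le_div_iff₀ (by positivity)]
      linarith
    · have hle := Int.floor_le y
      rw [hk] at hle
      have h1 : y ≤ Real.logb 2 T := by
        refine Real.logb_le_logb_of_le (by norm_num) (by positivity) (div_le_self hT0.le hc1)
      exact_mod_cast hle.trans h1

end NumExperts

/-! ### Numerical estimates and assembly of the regret bound. -/

lemma mul_sqrt_inv_le {lam n : ℝ} (hlam : 0 ≤ lam) (hn : 0 < n) :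
    lam * √(1 / ((1 + 2 * lam) * n)) ≤ max (√lam) 1 / √n := by
  have hl := le_sq_max_sqrt lam
  rw [le_div_iff₀ (Real.sqrt_pos.2 hn)]
  refine abs_le_of_sq_le_sq' ?_ (zero_le_one.trans (le_max_right _ _)) |>.2
  refine le_trans ?_ hl
  rw [mul_pow, mul_pow, Real.sq_sqrt (by positivity), Real.sq_sqrt hn.le,
    show lam ^ 2 * (1 / ((1 + 2 * lam) * n)) * n = lam ^ 2 / (1 + 2 * lam) by field_simp,
    div_le_iff₀ (by positivity)]
  nlinarith

/-- The regret of online gradient descent tuned to an interval length between `τ` and `2 τ`. -/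
lemma ogd_bound_le {T : ℕ} {lam G D τ : ℝ} (hlam : 0 ≤ lam) (hG : 0 < G) (hD : 0 < D) (hτ : 0 < τ)
    {i : ℕ} (h1 : τ ≤ intervalLen T i) (h2 : intervalLen T i ≤ 2 * τ) :
    D ^ 2 / (2 * stepSize T lam G D i)
      + τ * ((1 + 2 * lam) * stepSize T lam G D i * G ^ 2 / 2) ≤ 2 * G * D * √((1 + lam) * τ) := by
  have hn : 0 < intervalLen T i := hτ.trans_le h1
  set n := intervalLen T i with hn'
  have hP : 0 < 1 + 2 * lam := by positivity
  have hη : stepSize T lam G D i = D / G / (√(1 + 2 * lam) * √n) := by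
    rw [stepSize, Real.sqrt_div zero_le_one, Real.sqrt_one, Real.sqrt_mul hP.le, mul_one_div]
  have hPs : √(1 + 2 * lam) ^ 2 = 1 + 2 * lam := Real.sq_sqrt hP.le
  have hP0 : 0 < √(1 + 2 * lam) := Real.sqrt_pos.2 hP
  have hN0 : 0 < √n := Real.sqrt_pos.2 hn
  have ha0 : 0 < √τ := Real.sqrt_pos.2 hτ
  have hsq : √τ ^ 2 = τ := Real.sq_sqrt hτ.le
  have hNa : √τ ≤ √n := Real.sqrt_le_sqrt h1
  have hNa2 : √n ≤ 1415 / 1000 * √τ := by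
    refine (Real.sqrt_le_sqrt h2).trans ?_
    rw [Real.sqrt_mul (by norm_num)]
    gcongr
    exact sqrt_two_bounds.2
  have hPQ : √(1 + 2 * lam) ≤ 1415 / 1000 * √(1 + lam) := by
    refine (Real.sqrt_le_sqrt (by linarith : 1 + 2 * lam ≤ 2 * (1 + lam))).trans ?_
    rw [Real.sqrt_mul (by norm_num)]
    gcongr
    exact sqrt_two_bounds.2
  rw [hη, Real.sqrt_mul (by positivity)]
  have e : D ^ 2 / (2 * (D / G / (√(1 + 2 * lam) * √n)))
      + τ * ((1 + 2 * lam) * (D / G / (√(1 + 2 * lam) * √n)) * G ^ 2 / 2)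
      = G * D / 2 * (√(1 + 2 * lam) * (√n + τ / √n)) := by
    nth_rewrite 2 [← hPs]
    field_simp
  have hd : τ / √n ≤ √τ := by
    rw [div_le_iff₀ hN0]; nlinarith
  rw [e]
  calc _ ≤ G * D / 2 * (1415 / 1000 * √(1 + lam) * (1415 / 1000 * √τ + √τ)) := by gcongr
    _ ≤ _ := by
      have : 0 ≤ G * D * (√(1 + lam) * √τ) := by positivity
      linarith

lemma interval_error_le {T : ℕ} {Z τ N N' j : ℝ} (hτ : 0 < τ) (hτT : τ ≤ T) (hL : 1 ≤ Real.log T)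
    (hZ : Z = 1 / (T : ℝ)) (hN1 : √τ ≤ N) (hN2 : N ≤ 1415 / 1000 * √τ) (hN' : 0 ≤ N')
    (hj : j + 1 ≤ 3 * Real.log T) :
    42 / 10 * √(Real.log T) * (N + τ / N) + τ * Z
      + (105 / 10 * √(Real.log T) * (N - N') + j * (τ * Z)) ≤ 113 / 3 * (√τ * √(Real.log T)) := by
  have hT0 : (0 : ℝ) < T := hτ.trans_le hτT
  have ha0 : 0 < √τ := Real.sqrt_pos.2 hτ
  have haa : √τ * √τ = τ := Real.mul_self_sqrt hτ.le
  have hSS : √(Real.log T) * √(Real.log T) = Real.log T := Real.mul_self_sqrt (by linarith)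
  have hd : τ / N ≤ √τ := by
    rw [div_le_iff₀ (ha0.trans_le hN1)]; nlinarith
  -- The terms in Z total at most 3 τ log T / T, and one factor √(τ log T) ≤ T cancels the
  -- denominator.
  have herr : (j + 1) * (τ * Z) ≤ 3 * (√τ * √(Real.log T)) := by
    have hST : √(Real.log T) ≤ √(T : ℝ) := Real.sqrt_le_sqrt (Real.log_le_self hT0.le)
    have haN : √τ ≤ √(T : ℝ) := Real.sqrt_le_sqrt hτT
    have hprod : √τ * √(Real.log T) ≤ T := by
      calc _ ≤ √(T : ℝ) * √(T : ℝ) := by gcongr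
        _ = T := Real.mul_self_sqrt hT0.le
    rw [hZ, mul_one_div, mul_div_assoc', div_le_iff₀ hT0]
    calc _ ≤ 3 * Real.log T * τ := by gcongr
      _ = 3 * (√(Real.log T) * √(Real.log T)) * (√τ * √τ) := by rw [hSS, haa]
      _ = 3 * (√τ * √(Real.log T)) * (√τ * √(Real.log T)) := by ring
      _ ≤ _ := by gcongr
  have h1 : √(Real.log T) * (N + τ / N) ≤ √(Real.log T) * (1415 / 1000 * √τ + √τ) := by gcongr
  have h2 : √(Real.log T) * (N - N') ≤ √(Real.log T) * (1415 / 1000 * √τ) := by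
    gcongr; linarith
  have h3 : 0 ≤ √τ * √(Real.log T) := by positivity
  linarith

lemma sum_roundLoss_sub_le {W : Set E} {f : ℕ → E → ℝ} {T : ℕ} {lam G D c : ℝ} {w : ℕ → E}
    (hG : 0 < G) (hfD : ∀ t < T, ∀ x ∈ W, ∀ y ∈ W, f t x - f t y ≤ G * D)
    (hw : ∀ t, w t ∈ W) (hwc : ∀ t < T, lam * ‖w t - w (t + 1)‖ ≤ c) {u : E} (hu : u ∈ W)
    {r q : ℕ} (hrq : r ≤ q) (hqT : q ≤ T) :
    ∑ t ∈ Finset.Ico r q, (roundLoss f lam G w t - f t u) ≤ ((q : ℝ) - r) * (G * D + G * c) := by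
  have h : ∀ t ∈ Finset.Ico r q, roundLoss f lam G w t - f t u ≤ G * D + G * c := fun t ht => by
    have ht' : t < T := lt_of_lt_of_le (Finset.mem_Ico.1 ht).2 hqT
    have h1 := hfD t ht' _ (hw t) _ hu
    have h2 := mul_le_mul_of_nonneg_left (hwc t ht') hG.le
    unfold roundLoss
    linarith
  refine (Finset.sum_le_card_nsmul _ _ _ h).trans_eq ?_
  rw [Nat.card_Ico, nsmul_eq_mul, Nat.cast_sub hrq]

/-- The adaptive regret with switching cost of smoothed OGD on the interval `[r, q)`. -/
lemma smoothedOGD_regret_le [CompleteSpace E] {W : Set E} (hWclosed : IsClosed W)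
    (hWconvex : Convex ℝ W)
    {T : ℕ} {lam G D : ℝ} (hlam : 0 ≤ lam) (hG : 0 < G) (hD : 0 < D)
    {f : ℕ → E → ℝ} {grad : ℕ → E → E}
    (hfconvex : ∀ t < T, ConvexOn ℝ W (f t))
    (hgrad : ∀ t < T, ∀ x ∈ W, HasGradientWithinAt (f t) (grad t x) W x)
    (hgradbound : ∀ t < T, ∀ x ∈ W, ‖grad t x‖ ≤ G)
    (hdiam : ∀ x ∈ W, ∀ y ∈ W, ‖x - y‖ ≤ D)
    (hL : 1 ≤ Real.log T)
    {w₁ : ℕ → E} (hw₁ : ∀ i, w₁ i ∈ W) {Z : ℝ} (hZ : Z = 1 / (T : ℝ))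
    {r q : ℕ} (hrq : r < q) (hqT : q ≤ T) {u : E} (hu : u ∈ W) :
    ∑ t ∈ Finset.Ico r q, (roundLoss f lam G
        (smoothedOGD W f grad T lam G D (numExperts T lam Z) 2 Z w₁) t - f t u)
      ≤ 2 * G * D * √((1 + lam) * ((q : ℝ) - r))
          + 113 * G * D * max (√lam) 1 * √(((q : ℝ) - r) * Real.log (T : ℝ)) := by
  have hT : 0 < T := by omega
  have hT0 : (0 : ℝ) < T := by positivity
  have hlog : Real.log (1 / Z) = Real.log T := by rw [hZ, one_div_one_div]
  have hfD : ∀ t < T, ∀ x ∈ W, ∀ y ∈ W, f t x - f t y ≤ G * D := fun t ht x hx y hy => by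
    refine (ConvexOn.le_inner_gradient (hfconvex t ht) (hgrad t ht x hx) hx hy).trans ?_
    refine (real_inner_le_norm _ _).trans ?_
    gcongr
    · exact hgradbound t ht x hx
    · exact hdiam x hx y hy
  have hm : 1 ≤ max (√lam) 1 := le_max_right _ _
  obtain ⟨k, hk, hshort, hk'⟩ := exists_numExperts (Z := Z) hT hlam (hlog ▸ hL)
  rw [hk, smoothedOGD]
  have hτ : (0 : ℝ) < (q : ℝ) - r := sub_pos.2 (by exact_mod_cast hrq)
  have hτT : (q : ℝ) - r ≤ T := by
    have : (q : ℝ) ≤ T := by exact_mod_cast hqT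
    have : (0 : ℝ) ≤ r := by positivity
    linarith
  set τ : ℝ := (q : ℝ) - r with hτdef
  rw [Real.sqrt_mul hτ.le]
  have ha0 : 0 < √τ := Real.sqrt_pos.2 hτ
  have haa : √τ * √τ = τ := Real.mul_self_sqrt hτ.le
  have hS1 : 1 ≤ √(Real.log T) := Real.one_le_sqrt.2 hL
  have hSS : √(Real.log T) * √(Real.log T) = Real.log T := Real.mul_self_sqrt (by linarith)
  have hshort' : √(intervalLen T (k + 1)) ≤ 8 * (max (√lam) 1 * √(Real.log T)) := by
    refine Real.sqrt_le_iff.2 ⟨by positivity, hshort.trans_eq ?_⟩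
    rw [hlog, mul_pow, mul_pow, sq (√(Real.log T)), hSS]
    ring
  have hX : 0 ≤ G * D * √((1 + lam) * τ) := by positivity
  have hY : 0 ≤ G * D * (max (√lam) 1 * √τ * √(Real.log T)) := by positivity
  -- With a single expert no lower bound on the interval length is available, but T ≤ 64Λ² log T, so
  -- bounding the loss round by round suffices.
  rcases Nat.eq_zero_or_pos k with rfl | hkpos
  · rw [zero_add, intervalLen_one] at hshort'
    have h := sum_roundLoss_sub_le hG hfD
      (w := chain W f grad T lam G D 2 Z w₁ (0 + 1)) (fun t => expert_mem hWclosed hWconvex hw₁ 1 t)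
      (fun t ht => norm_expert_sub_succ_le hWclosed hWconvex hw₁ hlam hG hD hgradbound 1 ht) hu
      hrq.le hqT
    refine h.trans ?_
    rw [intervalLen_one]
    have h1 := mul_sqrt_inv_le hlam hT0
    have hN0 : 0 < √(T : ℝ) := Real.sqrt_pos.2 hT0
    have haN : √τ ≤ √(T : ℝ) := Real.sqrt_le_sqrt hτT
    have h2 : τ * (lam * √(1 / ((1 + 2 * lam) * T))) ≤ max (√lam) 1 * √τ := by
      calc _ ≤ τ * (max (√lam) 1 / √(T : ℝ)) := by gcongr
        _ = (√τ * √τ) * (max (√lam) 1 / √(T : ℝ)) := by rw [haa]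
        _ = max (√lam) 1 * √τ * (√τ / √(T : ℝ)) := by ring
        _ ≤ max (√lam) 1 * √τ * 1 := by gcongr; exact (div_le_one hN0).2 haN
        _ = _ := mul_one _
    have h3 : τ ≤ 8 * (max (√lam) 1 * √τ * √(Real.log T)) := by nlinarith
    have h4 : max (√lam) 1 * √τ ≤ max (√lam) 1 * √τ * √(Real.log T) :=
      le_mul_of_one_le_right (by positivity) hS1
    have h5 := mul_le_mul_of_nonneg_left (add_le_add h3 (h2.trans h4))
      (by positivity : 0 ≤ G * D)
    linarith
  obtain ⟨hbig, hklog⟩ := hk'.resolve_left hkpos.ne'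
  rw [← hlog] at hL
  -- An interval no longer than the shortest scale costs at most 3GDτ, and √τ ≤ 8Λ√(log T). Longer
  -- ones have a matching expert i + 1, with j further levels above it.
  rcases le_or_gt τ (intervalLen T (k + 1)) with hlong | hlong
  · have h := sum_roundLoss_sub_le hG hfD
      (w := chain W f grad T lam G D 2 Z w₁ (k + 1))
      (fun t => chain_mem hWclosed hWconvex hw₁ 2 k t)
      (fun t ht => norm_chain_sub_succ_le_two hWclosed hWconvex hw₁ hlam hG hD hgradbound hdiam
        hfD hZ hL hbig le_rfl ht) hu hrq.le hqT
    refine h.trans ?_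
    have h3 : τ ≤ 8 * (max (√lam) 1 * √τ * √(Real.log T)) := by
      nlinarith [Real.sqrt_le_sqrt hlong]
    have h5 := mul_le_mul_of_nonneg_left h3 (by positivity : 0 ≤ G * D)
    linarith
  obtain ⟨i, hik, hi1, hi2⟩ := exists_intervalLen hτT hlong
  obtain ⟨j, rfl⟩ := Nat.exists_eq_add_of_le hik
  have hη : 0 < stepSize T lam G D (i + 1) := by
    have := intervalLen_pos hT (i + 1)
    unfold stepSize; positivity
  have hA := ogd_regret_le (lam := lam) hWclosed hWconvex hfconvex hgrad hgradbound hdiam hlam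
    hG.le (hw₁ (i + 1)) hη hu hrq.le hqT
  rw [← hτdef] at hA
  replace hA := hA.trans (ogd_bound_le hlam hG hD hτ hi1 hi2)
  have hB := sum_roundLoss_chain_le_expert hWclosed hWconvex hw₁ hlam hG hD hfconvex hgradbound
    hdiam hfD hZ hL hbig hrq hqT (i := i) (by omega)
  have hC := sum_roundLoss_chain_le hWclosed hWconvex hw₁ hlam hG hD hfconvex hgradbound
    hdiam hfD hZ hL hbig hrq hqT i j le_rfl
  rw [Finset.sum_sub_distrib] at hA ⊢
  rw [hlog, ← hτdef] at hB hC
  have hN1 : √τ ≤ √(intervalLen T (i + 1)) := Real.sqrt_le_sqrt hi1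
  have hN2 : √(intervalLen T (i + 1)) ≤ 1415 / 1000 * √τ := by
    refine (Real.sqrt_le_sqrt hi2).trans ?_
    rw [Real.sqrt_mul (by norm_num)]
    gcongr
    exact sqrt_two_bounds.2
  have hN3 : 0 ≤ √(intervalLen T (i + j + 1)) := Real.sqrt_nonneg _
  rw [hlog] at hL
  have hj : (j : ℝ) + 1 ≤ 3 * Real.log T := by
    have h2 : Real.logb 2 T ≤ 2 * Real.log T := by
      rw [Real.logb, div_le_iff₀ (Real.log_pos one_lt_two)]
      nlinarith [Real.log_two_gt_d9]
    push_cast at hklog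
    have : (0 : ℝ) ≤ i := by positivity
    linarith
  have hsum := interval_error_le hτ hτT hL hZ hN1 hN2 hN3 hj
  have hfin := mul_le_mul_of_nonneg_left hsum (by positivity : 0 ≤ 3 * G * D * max (√lam) 1)
  unfold expert at hB
  linarith

lemma regret_bound_le {lam G D τ L : ℝ} (hlam : 0 ≤ lam) (hG : 0 < G) (hD : 0 < D) (hτ : 0 ≤ τ)
    (hL : 1 ≤ L) :
    2 * G * D * √((1 + lam) * τ) + 113 * G * D * max (√lam) 1 * √(τ * L)
      ≤ 115 * G * D * √((1 + lam) * τ * L) := by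
  have h1 : √((1 + lam) * τ) ≤ √((1 + lam) * τ * L) :=
    Real.sqrt_le_sqrt (le_mul_of_one_le_right (by positivity) hL)
  have h2 : max (√lam) 1 ≤ √(1 + lam) :=
    max_le (Real.sqrt_le_sqrt (by linarith)) (Real.one_le_sqrt.2 (by linarith))
  have h3 : max (√lam) 1 * √(τ * L) ≤ √((1 + lam) * τ * L) := by
    rw [mul_assoc (1 + lam), Real.sqrt_mul (by positivity : 0 ≤ 1 + lam)]
    gcongr
  have h4 := mul_le_mul_of_nonneg_left h1 (by positivity : 0 ≤ G * D)
  have h5 := mul_le_mul_of_nonneg_left h3 (by positivity : 0 ≤ G * D)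
  linarith

end SOCO

end

theorem mainTheorem3 {E : Type*} [NormedAddCommGroup E] [InnerProductSpace ℝ E] [CompleteSpace E]
    (W : Set E) (hWclosed : IsClosed W) (hWconvex : Convex ℝ W)
    (T : ℕ) (lam G D : ℝ) (hlam : 0 ≤ lam) (hG : 0 < G) (hD : 0 < D)
    (f : ℕ → E → ℝ) (grad : ℕ → E → E)
    (hfconvex : ∀ t < T, ConvexOn ℝ W (f t))
    (hgrad : ∀ t < T, ∀ x ∈ W, HasGradientWithinAt (f t) (grad t x) W x)
    (hgradbound : ∀ t < T, ∀ x ∈ W, ‖grad t x‖ ≤ G)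
    (hdiam : ∀ x ∈ W, ∀ y ∈ W, ‖x - y‖ ≤ D)
    (hT : max (√lam * Real.logb 2 (T : ℝ)) (Real.exp 1) ≤ (T : ℝ))
    (w₁ : ℕ → E) (hw₁ : ∀ i, w₁ i ∈ W)
    (Z : ℝ) (hZ : Z = 1 / (T : ℝ))
    (w : ℕ → E)
    (hw : w = SOCO.smoothedOGD W f grad T lam G D (SOCO.numExperts T lam Z) 2 Z w₁)
    (r s : ℕ) (hrs : r ≤ s) (hsT : s < T)
    (τ : ℝ) (hτ : τ = (s : ℝ) - (r : ℝ) + 1)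
    (u : E) (hu : u ∈ W) :
    ∑ t ∈ Finset.Icc r s, (f t (w t) + lam * G * ‖w t - w (t + 1)‖ - f t u)
        ≤ 2 * G * D * √((1 + lam) * τ)
          + 113 * G * D * max (√lam) 1 * √(τ * Real.log (T : ℝ)) ∧
      2 * G * D * √((1 + lam) * τ)
          + 113 * G * D * max (√lam) 1 * √(τ * Real.log (T : ℝ))
        ≤ 115 * G * D * √((1 + lam) * τ * Real.log (T : ℝ)) := by
  have hL : 1 ≤ Real.log (T : ℝ) := by
    rw [Real.le_log_iff_exp_le (lt_of_lt_of_le (Real.exp_pos 1) ((le_max_right _ _).trans hT))]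
    exact (le_max_right _ _).trans hT
  have hτ' : ((s + 1 : ℕ) : ℝ) - r = τ := by rw [hτ]; push_cast; ring
  have hτ0 : 0 ≤ τ := by
    have : (r : ℝ) ≤ s := by exact_mod_cast hrs
    linarith
  refine ⟨?_, SOCO.regret_bound_le hlam hG hD hτ0 hL⟩
  have h := SOCO.smoothedOGD_regret_le hWclosed hWconvex hlam hG hD hfconvex hgrad hgradbound hdiam
    hL hw₁ hZ (show r < s + 1 by omega) (show s + 1 ≤ T by omega) hu
  rw [hτ', ← hw] at h
  have hI : Finset.Icc r s = Finset.Ico r (s + 1) := by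
    ext t
    simp only [Finset.mem_Icc, Finset.mem_Ico]
    omega
  rw [hI]
  exact h
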